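/- Let $A$ be a unital $C^*$-algebra and let $\mathrm{T}(A)$ be its set of tracial states, with the weak-$*$ topology. Let $\mathrm{Aff}(\mathrm{T}(A))$ be the set of continuous affine functions $\mathrm{T}(A)\to\mathbb{R}$, and let $\mathrm{M}_\infty(A)=\bigcup_n \mathrm{M}_n(A)$, where $\mathrm{M}_n(A)$ sits in $\mathrm{M}_{n+1}(A)$ as the upper left corner; each $\tau\in \mathrm{T}(A)$ is extended to $\mathrm{M}_\infty(A)$ by $\tau((a_{ij}))=\sum_i\tau(a_{ii})$. For positive $a,b\in \mathrm{M}_\infty(A)$ write $a\precsim b$ if there is a sequence $(v_k)$ in $\mathrm{M}_\infty(A)$ with $v_kbv_k^*\to a$ in norm, and $a\sim b$ if $a\precsim b$ and $b\precsim a$. The Cuntz semigroup $W(A)$ is the set of $\sim$-classes $\langle a\rangle$ of positive elements $a$ of $\mathrm{M}_\infty(A)$, an ordered abelian monoid with $\langle a\rangle+\langle b\rangle=\langle a\oplus b\rangle$ and $\langle a\rangle\le\langle b\rangle \Leftrightarrow a\precsim b$. For $\tau\in \mathrm{T}(A)$ and positive $a\in\mathrm{M}_\infty(A)$ put $d_\tau(a)=\lim_{k\to\infty}\tau(a^{1/k})$.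 The algebra $A$ has strict comparison of positive elements if, for all positive $a,b\in \mathrm{M}_\infty(A)$, $d_\tau(a)<d_\tau(b)$ for every $\tau\in \mathrm{T}(A)$ implies $a\precsim b$. **Proposition.** Let $A$ be a unital, simple, stably finite $C^*$-algebra with strict comparison of positive elements. Suppose that for every $f\in\mathrm{Aff}(\mathrm{T}(A))$ with $f(\tau)>0$ for all $\tau\in\mathrm{T}(A)$ and every $\epsilon>0$ there is a positive $a\in \mathrm{M}_\infty(A)$ such that $$|f(\tau)-d_\tau(a)|<\epsilon \quad\text{for all } \tau\in \mathrm{T}(A).$$ Then $W(A)$ is almost divisible: for every $x\in W(A)$ and $n\in\mathbb{N}$ there is $y\in W(A)$ with $ny\le x\le (n+1)y$. -/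

import Mathlib

open Filter Topology
open scoped ComplexOrder

set_option linter.unusedSectionVars false

namespace CuntzDiv

section Cuntz

variable {A : Type*} [CStarAlgebra A] [PartialOrder A] [StarOrderedRing A]

/-- Cuntz subequivalence `a ≾ b` for square matrices over `A`, possibly of different sizes: there
is a sequence of matrices `v k` over `A`, of the (rectangular) shape for which the products make
sense, such that `v k * b * (v k)ᴴ → a`. The topology is that of the C⋆-norm on matrices. When all
matrices are regarded as elements of the union `M_∞(A)` (upper left corners), this is the same as
asking for a sequence in `M_∞(A)`, since that sequence can be compressed by the units of the
two corners. -/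
def CuntzLE {m n : Type*} [Fintype m] [Fintype n]
    (a : CStarMatrix m m A) (b : CStarMatrix n n A) : Prop :=
  ∃ v : ℕ → CStarMatrix m n A, Tendsto (fun k => v k * b * (v k).conjTranspose) atTop (𝓝 a)

theorem continuous_conj {m n : Type*} [Fintype m] [Fintype n] (v : CStarMatrix m n A) :
    Continuous (fun b : CStarMatrix n n A => v * b * v.conjTranspose) := by
  have h : Continuous (fun b : Matrix n n A =>
      (CStarMatrix.ofMatrix.symm v * b) * (CStarMatrix.ofMatrix.symm v).conjTranspose) := by
    fun_prop
  exact h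

theorem conj_conj {l m n : Type*} [Fintype l] [Fintype m] [Fintype n]
    (w : CStarMatrix l m A) (v : CStarMatrix m n A) (c : CStarMatrix n n A) :
    w * (v * c * v.conjTranspose) * w.conjTranspose
      = (w * v) * c * (w * v).conjTranspose := by
  have h : ∀ (w : Matrix l m A) (v : Matrix m n A) (c : Matrix n n A),
      w * (v * c * v.conjTranspose) * w.conjTranspose
        = (w * v) * c * (w * v).conjTranspose := by
    intro w v c
    simp only [Matrix.conjTranspose_mul, Matrix.mul_assoc]
  exact h w v c

theorem cuntzLE_iff_mem_closure {m n : Type*} [Fintype m] [Fintype n]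
    (a : CStarMatrix m m A) (b : CStarMatrix n n A) :
    CuntzLE a b ↔
      a ∈ closure (Set.range fun v : CStarMatrix m n A => v * b * v.conjTranspose) := by
  rw [mem_closure_iff_seq_limit]
  constructor
  · rintro ⟨v, hv⟩
    exact ⟨_, fun k => ⟨v k, rfl⟩, hv⟩
  · rintro ⟨x, hx, hlim⟩
    choose v hv using hx
    refine ⟨v, ?_⟩
    simpa only [hv] using hlim

theorem CuntzLE.trans {l m n : Type*} [Fintype l] [Fintype m] [Fintype n]
    {a : CStarMatrix l l A} {b : CStarMatrix m m A} {c : CStarMatrix n n A}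
    (hab : CuntzLE a b) (hbc : CuntzLE b c) : CuntzLE a c := by
  rw [cuntzLE_iff_mem_closure] at *
  refine closure_minimal ?_ isClosed_closure hab
  rintro _ ⟨w, rfl⟩
  refine map_mem_closure (f := fun b : CStarMatrix m m A => w * b * w.conjTranspose)
    (continuous_conj w) hbc ?_
  rintro _ ⟨v, rfl⟩
  exact ⟨w * v, (conj_conj w v c).symm⟩

theorem CuntzLE.of_equiv {m n : Type*} [Fintype m] [Fintype n]
    {a : CStarMatrix m m A} {b : CStarMatrix n n A} (e : m ≃ n)
    (h : ∀ i j, a i j = b (e i) (e j)) : CuntzLE a b := by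
  classical
  let u : Matrix m n A := Matrix.of fun i k => if e i = k then 1 else 0
  have key : ∀ (a : Matrix m m A) (b : Matrix n n A), (∀ i j, a i j = b (e i) (e j)) →
      u * b * u.conjTranspose = a := by
    intro a b h
    ext i j
    rw [h]
    simp [u, Matrix.mul_apply, apply_ite star]
  exact ⟨fun _ => u, tendsto_const_nhds.congr fun _ => (key a b h).symm⟩

/-- The block diagonal matrix `a ⊕ b`. -/
def blockSum {m n : ℕ} (a : CStarMatrix (Fin m) (Fin m) A) (b : CStarMatrix (Fin n) (Fin n) A) :
    CStarMatrix (Fin (m + n)) (Fin (m + n)) A :=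
  CStarMatrix.ofMatrix ((Matrix.fromBlocks (CStarMatrix.ofMatrix.symm a) 0 0
    (CStarMatrix.ofMatrix.symm b)).reindex finSumFinEquiv finSumFinEquiv)

theorem exists_eq_star_mul_self {B : Type*} [CStarAlgebra B] [PartialOrder B] [StarOrderedRing B]
    {b : B} (hb : 0 ≤ b) : ∃ x, b = star x * x :=
  CStarAlgebra.nonneg_iff_eq_star_mul_self.mp hb

theorem blockSum_nonneg {m n : ℕ} {a : CStarMatrix (Fin m) (Fin m) A}
    {b : CStarMatrix (Fin n) (Fin n) A} (ha : 0 ≤ a) (hb : 0 ≤ b) : 0 ≤ blockSum a b := by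
  obtain ⟨x, rfl⟩ := exists_eq_star_mul_self ha
  obtain ⟨y, rfl⟩ := exists_eq_star_mul_self hb
  have h : blockSum (star x * x) (star y * y) = star (blockSum x y) * blockSum x y := by
    have h' : ∀ (x : Matrix (Fin m) (Fin m) A) (y : Matrix (Fin n) (Fin n) A),
        (Matrix.fromBlocks (x.conjTranspose * x) 0 0 (y.conjTranspose * y)).reindex
            finSumFinEquiv finSumFinEquiv
          = ((Matrix.fromBlocks x 0 0 y).reindex finSumFinEquiv finSumFinEquiv).conjTranspose
            * (Matrix.fromBlocks x 0 0 y).reindex finSumFinEquiv finSumFinEquiv := by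
      intro x y
      simp only [Matrix.reindex_apply, Matrix.conjTranspose_submatrix,
        Matrix.submatrix_mul_equiv, Matrix.fromBlocks_conjTranspose, Matrix.fromBlocks_multiply]
      simp
    exact h' x y
  rw [h]
  exact star_mul_self_nonneg _

theorem CuntzLE.blockSum {m n m' n' : ℕ}
    {a : CStarMatrix (Fin m) (Fin m) A} {b : CStarMatrix (Fin n) (Fin n) A}
    {a' : CStarMatrix (Fin m') (Fin m') A} {b' : CStarMatrix (Fin n') (Fin n') A}
    (ha : CuntzLE a a') (hb : CuntzLE b b') : CuntzLE (blockSum a b) (blockSum a' b') := by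
  obtain ⟨v, hv⟩ := ha
  obtain ⟨w, hw⟩ := hb
  let T : Matrix (Fin m) (Fin m) A × Matrix (Fin n) (Fin n) A →
      Matrix (Fin (m + n)) (Fin (m + n)) A := fun p =>
    (Matrix.fromBlocks p.1 0 0 p.2).reindex finSumFinEquiv finSumFinEquiv
  have hT : Continuous T := by
    simp only [T, Matrix.reindex_apply]
    fun_prop
  refine ⟨fun k => CStarMatrix.ofMatrix ((Matrix.fromBlocks (CStarMatrix.ofMatrix.symm (v k)) 0 0
    (CStarMatrix.ofMatrix.symm (w k))).reindex finSumFinEquiv finSumFinEquiv), ?_⟩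
  have key : ∀ (v : Matrix (Fin m) (Fin m') A) (w : Matrix (Fin n) (Fin n') A)
      (a' : Matrix (Fin m') (Fin m') A) (b' : Matrix (Fin n') (Fin n') A),
      (Matrix.fromBlocks v 0 0 w).reindex finSumFinEquiv finSumFinEquiv
        * (Matrix.fromBlocks a' 0 0 b').reindex finSumFinEquiv finSumFinEquiv
        * ((Matrix.fromBlocks v 0 0 w).reindex finSumFinEquiv finSumFinEquiv).conjTranspose
      = T (v * a' * v.conjTranspose, w * b' * w.conjTranspose) := by
    intro v w a' b'
    simp only [T, Matrix.reindex_apply, Matrix.conjTranspose_submatrix,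
      Matrix.submatrix_mul_equiv, Matrix.fromBlocks_conjTranspose, Matrix.fromBlocks_multiply]
    simp
  have hlim := (hT.tendsto (CStarMatrix.ofMatrix.symm a, CStarMatrix.ofMatrix.symm b)).comp
    (Tendsto.prodMk_nhds (f := atTop)
      (mx := fun k => CStarMatrix.ofMatrix.symm (v k * a' * (v k).conjTranspose))
      (my := fun k => CStarMatrix.ofMatrix.symm (w k * b' * (w k).conjTranspose)) hv hw)
  exact hlim.congr fun k => (key _ _ _ _).symm

theorem cuntzLE_refl {n : ℕ} (a : CStarMatrix (Fin n) (Fin n) A) : CuntzLE a a :=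
  CuntzLE.of_equiv (Equiv.refl _) fun _ _ => rfl

end Cuntz

/-- The positive elements of `M_∞(A) = ⋃ₙ Mₙ(A)`, each given as a positive matrix of some
(not necessarily minimal) size. The identification of `a` with its zero-padded versions is
contained in Cuntz equivalence. -/
structure PosMatrix (A : Type*) [CStarAlgebra A] [PartialOrder A] [StarOrderedRing A] where
  size : ℕ
  mat : CStarMatrix (Fin size) (Fin size) A
  nonneg : 0 ≤ mat

section Semigroup

variable {A : Type*} [CStarAlgebra A] [PartialOrder A] [StarOrderedRing A]

/-- `a ≤ b` on representatives is Cuntz subequivalence `a ≾ b`. -/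
instance : Preorder (PosMatrix A) where
  le a b := CuntzLE a.mat b.mat
  le_refl a := cuntzLE_refl a.mat
  le_trans _ _ _ h h' := CuntzLE.trans h h'

instance : Zero (PosMatrix A) := ⟨⟨0, 0, le_rfl⟩⟩

/-- The sum on representatives is the orthogonal sum `a ⊕ b`. -/
instance : Add (PosMatrix A) :=
  ⟨fun a b => ⟨a.size + b.size, blockSum a.mat b.mat, blockSum_nonneg a.nonneg b.nonneg⟩⟩

theorem PosMatrix.add_le_add' {a b a' b' : PosMatrix A} (h : a ≤ a') (h' : b ≤ b') :
    a + b ≤ a' + b' :=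
  CuntzLE.blockSum h h'

theorem PosMatrix.zero_add_equiv (a : PosMatrix A) : AntisymmRel (· ≤ ·) (0 + a) a := by
  have h : ∀ i j : Fin a.size, blockSum (0 : CStarMatrix (Fin 0) (Fin 0) A) a.mat
      (finSumFinEquiv (.inr i)) (finSumFinEquiv (.inr j)) = a.mat i j := by
    intro i j
    simp [blockSum, -finSumFinEquiv_apply_left, -finSumFinEquiv_apply_right]
  let e : Fin a.size ≃ Fin (0 + a.size) := (Equiv.emptySum (Fin 0) _).symm.trans finSumFinEquiv
  refine ⟨CuntzLE.of_equiv e.symm fun i j => ?_, CuntzLE.of_equiv e fun i j => (h i j).symm⟩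
  obtain ⟨i, rfl⟩ := e.surjective i
  obtain ⟨j, rfl⟩ := e.surjective j
  rw [e.symm_apply_apply, e.symm_apply_apply]
  exact h i j

theorem PosMatrix.add_comm_le (a b : PosMatrix A) : a + b ≤ b + a := by
  let e : Fin (a.size + b.size) ≃ Fin (b.size + a.size) :=
    finSumFinEquiv.symm.trans ((Equiv.sumComm _ _).trans finSumFinEquiv)
  refine CuntzLE.of_equiv e fun i j => ?_
  obtain ⟨i, rfl⟩ := finSumFinEquiv.surjective i
  obtain ⟨j, rfl⟩ := finSumFinEquiv.surjective j
  change blockSum a.mat b.mat _ _ = blockSum b.mat a.mat _ _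
  rcases i with i | i <;> rcases j with j | j <;>
    simp [blockSum, e, -finSumFinEquiv_apply_left, -finSumFinEquiv_apply_right]

theorem PosMatrix.add_assoc_equiv (a b c : PosMatrix A) :
    AntisymmRel (· ≤ ·) (a + b + c) (a + (b + c)) := by
  let e₁ : (Fin a.size ⊕ Fin b.size) ⊕ Fin c.size ≃ Fin (a.size + b.size + c.size) :=
    (Equiv.sumCongr finSumFinEquiv (Equiv.refl _)).trans finSumFinEquiv
  let e₂ : Fin a.size ⊕ (Fin b.size ⊕ Fin c.size) ≃ Fin (a.size + (b.size + c.size)) :=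
    (Equiv.sumCongr (Equiv.refl _) finSumFinEquiv).trans finSumFinEquiv
  let e := e₁.symm.trans ((Equiv.sumAssoc _ _ _).trans e₂)
  have h : ∀ i j, (a + b + c).mat i j = (a + (b + c)).mat (e i) (e j) := by
    intro i j
    obtain ⟨i, rfl⟩ := e₁.surjective i
    obtain ⟨j, rfl⟩ := e₁.surjective j
    simp only [e, Equiv.trans_apply, Equiv.symm_apply_apply]
    change blockSum (blockSum a.mat b.mat) c.mat _ _ = blockSum a.mat (blockSum b.mat c.mat) _ _
    rcases i with (i | i) | i <;> rcases j with (j | j) | j <;>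
      simp [blockSum, e₁, e₂, -finSumFinEquiv_apply_left, -finSumFinEquiv_apply_right]
  refine ⟨CuntzLE.of_equiv e h, CuntzLE.of_equiv e.symm fun i j => ?_⟩
  rw [h, e.apply_symm_apply, e.apply_symm_apply]

end Semigroup

/-- The (original) Cuntz semigroup `W(A)`: positive elements of `M_∞(A)` modulo Cuntz equivalence,
ordered by Cuntz subequivalence, with addition induced by the orthogonal sum. -/
def CuntzSemigroup (A : Type*) [CStarAlgebra A] [PartialOrder A] [StarOrderedRing A] : Type _ :=
  Antisymmetrization (PosMatrix A) (· ≤ ·)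

namespace CuntzSemigroup

variable {A : Type*} [CStarAlgebra A] [PartialOrder A] [StarOrderedRing A]

/-- The class `⟨a⟩` of a positive element `a` of `M_∞(A)`. -/
def mk (a : PosMatrix A) : CuntzSemigroup A := toAntisymmetrization (· ≤ ·) a

instance : PartialOrder (CuntzSemigroup A) :=
  inferInstanceAs (PartialOrder (Antisymmetrization (PosMatrix A) (· ≤ ·)))

theorem mk_le_mk {a b : PosMatrix A} : mk a ≤ mk b ↔ CuntzLE a.mat b.mat := Iff.rfl

instance : Zero (CuntzSemigroup A) := ⟨mk 0⟩

instance : Add (CuntzSemigroup A) :=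
  ⟨Quotient.map₂ (· + ·) fun _ _ h _ _ h' =>
    ⟨PosMatrix.add_le_add' h.1 h'.1, PosMatrix.add_le_add' h.2 h'.2⟩⟩

theorem mk_add_mk (a b : PosMatrix A) : mk a + mk b = mk (a + b) := rfl

theorem add_comm' (x y : CuntzSemigroup A) : x + y = y + x :=
  Quotient.inductionOn₂ x y fun a b =>
    Quotient.sound ⟨PosMatrix.add_comm_le a b, PosMatrix.add_comm_le b a⟩

theorem zero_add' (x : CuntzSemigroup A) : 0 + x = x :=
  Quotient.inductionOn x fun a => Quotient.sound (PosMatrix.zero_add_equiv a)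

instance : AddCommMonoid (CuntzSemigroup A) where
  add_assoc x y z := Quotient.inductionOn₃ x y z fun a b c =>
    Quotient.sound (PosMatrix.add_assoc_equiv a b c)
  zero_add := zero_add'
  add_zero x := (add_comm' x 0).trans (zero_add' x)
  add_comm := add_comm'
  nsmul := nsmulRec

instance : IsOrderedAddMonoid (CuntzSemigroup A) where
  add_le_add_left x y h z := by
    induction x using Quotient.inductionOn with | _ a
    induction y using Quotient.inductionOn with | _ b
    induction z using Quotient.inductionOn with | _ c
    exact PosMatrix.add_le_add' h (le_refl c)

end CuntzSemigroup

/-- An ordered monoid is almost divisible if for all `x` and `n` there is `y` with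
`n y ≤ x ≤ (n + 1) y`. -/
def AlmostDivisible (W : Type*) [AddCommMonoid W] [LE W] : Prop :=
  ∀ (x : W) (n : ℕ), ∃ y : W, n • y ≤ x ∧ x ≤ (n + 1) • y

section CStar

variable (A : Type*) [CStarAlgebra A] [PartialOrder A] [StarOrderedRing A]

/-- Simplicity of a C⋆-algebra: it is nonzero and has only the trivial closed two-sided ideals. -/
def IsSimpleCStar (A : Type*) [CStarAlgebra A] : Prop :=
  Nontrivial A ∧ ∀ I : TwoSidedIdeal A, IsClosed (I : Set A) → I = ⊥ ∨ I = ⊤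

/-- Stable finiteness: in every matrix algebra `Mₙ(A)`, every isometry is a unitary. -/
def IsStablyFinite : Prop :=
  ∀ (n : ℕ) (v : CStarMatrix (Fin n) (Fin n) A), star v * v = 1 → v * star v = 1

/-- The set `T(A)` of tracial states, inside the dual of `A` with the weak-⋆ topology. -/
def tracialStates : Set (WeakDual ℂ A) :=
  {τ | (∀ a : A, 0 ≤ a → 0 ≤ τ a) ∧ τ 1 = 1 ∧ ∀ a b : A, τ (a * b) = τ (b * a)}

/-- `Aff(T(A))`: the continuous affine real-valued functions on `T(A)`. -/
def Aff : Set C(tracialStates A, ℝ) :=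
  {f | ∀ (ρ σ τ : tracialStates A) (s t : ℝ), 0 ≤ s → 0 ≤ t → s + t = 1 →
    (ρ : WeakDual ℂ A) = (s : ℂ) • (σ : WeakDual ℂ A) + (t : ℂ) • (τ : WeakDual ℂ A) →
    f ρ = s * f σ + t * f τ}

variable {A}

/-- The extension of a trace `τ` to `Mₙ(A)`, `τ(a) = ∑ᵢ τ(aᵢᵢ)` (not normalized); it is real-valued
on positive elements, and we take its real part. -/
noncomputable def matrixTrace {n : ℕ} (τ : tracialStates A)
    (a : CStarMatrix (Fin n) (Fin n) A) : ℝ :=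
  (∑ i, (τ : WeakDual ℂ A) (a i i)).re

/-- The `k`-th root `b^{1/k}` of a positive element `b` of a unital C⋆-algebra, by continuous
functional calculus. -/
noncomputable def root {B : Type*} [CStarAlgebra B] (k : ℕ) (b : B) : B :=
  cfc (fun t : ℝ => t ^ (1 / (k : ℝ))) b

/-- `d_τ(a) = lim_k τ(a^{1/k})`, the root being taken in `Mₙ(A)`. The limit exists for every
positive `a`. -/
noncomputable def dimFun (τ : tracialStates A) (a : PosMatrix A) : ℝ :=
  limUnder atTop fun k : ℕ => matrixTrace τ (root k a.mat)

variable (A)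

/-- Strict comparison of positive elements: `a ≾ b` whenever `d_τ(a) < d_τ(b)` for every tracial
state `τ`. -/
def StrictComparison : Prop :=
  ∀ a b : PosMatrix A, (∀ τ : tracialStates A, dimFun τ a < dimFun τ b) → CuntzLE a.mat b.mat

end CStar

end CuntzDiv

/-! By strict comparison it suffices, for `a ≠ 0` and `n ≥ 1`, to find `y` with `d_τ(a)/(n+1) <
d_τ(y) < d_τ(a)/n` for every `τ`. The density hypothesis does not apply to `d_τ(a)` directly, which
is only lower semicontinuous in `τ`.

So `d_τ(a)` is written as `∑ τ(c_k)`, where `c_k = bump k (a)` are positive contractions, orthogonal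
once their indices differ by at least 2 (`hasSum_bump`, `realCfc_bump_mul`). Each `τ ↦ τ(c_k)` is
continuous and affine, and strictly positive if `c_k ≠ 0`, since tracial states on a simple algebra
are faithful. Density then gives an element of rank between `τ(c_k)/(n+1)` and `τ(c_k)/n`; strict
comparison places it below `c_k`, and a cut-down of it is moved into the hereditary subalgebra of
`c_k` without leaving the interval (`exists_dim_mem_Ioo`). This yields `z_k` that inherit the
orthogonality of the `c_k`.

The weighted sums of the `z_k` over even and over odd `k` converge in norm, and their ranks are the
sums of the ranks (`exists_hasSum_dim`). Their orthogonal sum is `y`. -/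

namespace CuntzDiv

/-! ### Polynomial approximation in the functional calculus -/

section FunctionalCalculus

variable {B : Type*} [CStarAlgebra B] [PartialOrder B] [StarOrderedRing B]

theorem abs_le_norm_of_mem_spectrum {a : B} {s : ℝ} (hs : s ∈ spectrum ℝ a) : |s| ≤ ‖a‖ := by
  rcases subsingleton_or_nontrivial B with h | h
  · simp [spectrum.of_subsingleton] at hs
  · exact spectrum.norm_le_norm_of_mem hs

theorem norm_aeval_sub_cfc_le {f : ℝ → ℝ} (hf : Continuous f) {p : Polynomial ℝ} {M ε : ℝ}
    (hε : 0 ≤ ε) (hp : ∀ s ∈ Set.Icc (-M) M, |p.eval s - f s| ≤ ε) {a : B}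
    (ha : IsSelfAdjoint a) (hM : ‖a‖ ≤ M) : ‖Polynomial.aeval a p - cfc f a‖ ≤ ε := by
  rw [← cfc_polynomial p a, ← cfc_sub (p.eval ·) f a]
  exact norm_cfc_le hε fun s hs =>
    hp s (abs_le.mp ((abs_le_norm_of_mem_spectrum hs).trans hM))

/-- Dropping the constant term of a Weierstrass approximant at most doubles the error, as `f 0 = 0`.
No constant term is allowed because `1` has different traces in matrix algebras of different size.
-/
theorem exists_polynomial_mul_near {f : ℝ → ℝ} (hf : Continuous f) (h0 : f 0 = 0) (M : ℝ)
    {ε : ℝ} (hε : 0 < ε) :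
    ∃ p : Polynomial ℝ, ∀ s ∈ Set.Icc (-M) M, |(Polynomial.X * p).eval s - f s| ≤ ε := by
  obtain ⟨p, hp⟩ := exists_polynomial_near_of_continuousOn (-M) M f hf.continuousOn (ε / 2)
    (by positivity)
  refine ⟨p.divX, fun s hs => ?_⟩
  have hM : (0 : ℝ) ∈ Set.Icc (-M) M := by
    have := hs.1.trans hs.2
    constructor <;> linarith
  have h1 := hp s hs
  have h2 := hp 0 hM
  have h3 := congrArg (Polynomial.eval s) p.X_mul_divX_add
  simp only [Polynomial.eval_add, Polynomial.eval_C] at h3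
  rw [← Polynomial.coeff_zero_eq_eval_zero, h0] at h2
  rw [abs_lt] at h1 h2
  rw [abs_le]
  constructor <;> linarith [h1.1, h1.2, h2.1, h2.2]

theorem tendsto_cfc_of_tendsto {f : ℝ → ℝ} (hf : Continuous f) {u : ℕ → B} {a : B}
    (hu : ∀ k, IsSelfAdjoint (u k)) (ha : IsSelfAdjoint a) (h : Tendsto u atTop (𝓝 a)) :
    Tendsto (fun k => cfc f (u k)) atTop (𝓝 (cfc f a)) := by
  have hb : ∀ᶠ k in atTop, ‖u k‖ < ‖a‖ + 1 := h.norm.eventually_lt_const (by linarith)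
  refine Filter.Tendsto.cfc (s := Set.Icc (-(‖a‖ + 1)) (‖a‖ + 1)) isCompact_Icc f h ?_ ?_ ?_ ?_ ?_
  · filter_upwards [hb] with k hk s hs
    exact abs_le.mp ((abs_le_norm_of_mem_spectrum hs).trans hk.le)
  · exact Eventually.of_forall hu
  · exact fun s hs => abs_le.mp ((abs_le_norm_of_mem_spectrum hs).trans (by linarith))
  · exact ha
  · exact hf.continuousOn

theorem cfc_mul_eq_zero {f : ℝ → ℝ} (hf : Continuous f) (h0 : f 0 = 0) {a b : B}
    (ha : IsSelfAdjoint a) (hab : a * b = 0) : cfc f a * b = 0 := by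
  rw [← norm_le_zero_iff]
  refine le_of_forall_pos_le_add fun ε hε => ?_
  obtain ⟨p, hp⟩ := exists_polynomial_mul_near hf h0 ‖a‖ (ε := ε / (‖b‖ + 1)) (by positivity)
  have h1 := norm_aeval_sub_cfc_le hf (by positivity) hp ha le_rfl
  have h2 : Polynomial.aeval a (Polynomial.X * p) * b = 0 := by
    rw [mul_comm, map_mul, Polynomial.aeval_X, mul_assoc, hab, mul_zero]
  have h3 : cfc f a * b = -((Polynomial.aeval a (Polynomial.X * p) - cfc f a) * b) := by
    rw [sub_mul, h2]; simp
  rw [h3, norm_neg]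
  calc _ ≤ ε / (‖b‖ + 1) * ‖b‖ := (norm_mul_le _ _).trans (by gcongr)
    _ ≤ ε / (‖b‖ + 1) * (‖b‖ + 1) := by gcongr; linarith
    _ = 0 + ε := by field_simp; ring

end FunctionalCalculus

/-! ### Positive traces, cut-off functions and rank -/

/-- A bounded (not necessarily normalized) positive trace on a C⋆-algebra. -/
structure IsPosTrace {B : Type*} [CStarAlgebra B] [PartialOrder B] (t : B →L[ℝ] ℝ) : Prop where
  nonneg : ∀ a, 0 ≤ a → 0 ≤ t a
  comm : ∀ a b, t (a * b) = t (b * a)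

/-- The piecewise linear functions increasing to the indicator function of `(0, ∞)`. -/
noncomputable def cut (k : ℕ) (s : ℝ) : ℝ := max 0 (min 1 (2 ^ k * s - 1))

theorem continuous_cut (k : ℕ) : Continuous (cut k) := by unfold cut; fun_prop

theorem cut_zero (k : ℕ) : cut k 0 = 0 := by simp [cut]

theorem cut_nonneg (k : ℕ) (s : ℝ) : 0 ≤ cut k s := le_max_left _ _

theorem cut_le_one (k : ℕ) (s : ℝ) : cut k s ≤ 1 := by simp [cut]

theorem cut_mono {k l : ℕ} (h : k ≤ l) {s : ℝ} (hs : 0 ≤ s) : cut k s ≤ cut l s := by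
  unfold cut
  have : (2 : ℝ) ^ k ≤ 2 ^ l := pow_le_pow_right₀ (by norm_num) h
  gcongr

theorem cut_eq_zero {k : ℕ} {s : ℝ} (h : 2 ^ k * s ≤ 1) : cut k s = 0 := by
  unfold cut
  rw [max_eq_left]
  exact (min_le_right _ _).trans (by linarith)

theorem cut_eq_one {k : ℕ} {s : ℝ} (h : 2 ≤ 2 ^ k * s) : cut k s = 1 := by
  unfold cut
  rw [min_eq_left (by linarith), max_eq_right zero_le_one]

/-- Where `cut k s` is nonzero it is at most `2 ^ k * (s - 2⁻ᵏ)`. The two outer factors allow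
compressing an inequality `a - 2⁻ᵏ ≤ b` by `cut k (a)`. -/
theorem cut_pow_three_le (k : ℕ) (s : ℝ) :
    cut k s ^ 3 ≤ 2 ^ k * (cut k s * (s - (2 ^ k)⁻¹) * cut k s) := by
  have h2 : (0 : ℝ) < 2 ^ k := by positivity
  rcases le_total (2 ^ k * s) 1 with h | h
  · simp [cut_eq_zero h]
  · have h1 : cut k s ≤ 2 ^ k * s - 1 := by
      unfold cut
      exact max_le (by linarith) (min_le_right _ _)
    calc cut k s ^ 3 = cut k s ^ 2 * cut k s := by ring
      _ ≤ cut k s ^ 2 * (2 ^ k * s - 1) := by gcongr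
      _ = _ := by field_simp

/-- Near `0` the function `f` is below `ε`; away from `0` the cut-off is already `1`. -/
theorem exists_le_cut_add {f : ℝ → ℝ} (hf : Continuous f) (h0 : f 0 = 0) {ε : ℝ} (hε : 0 < ε) :
    ∃ k, ∀ s, 0 ≤ s → f s ≤ 1 → f s ≤ cut k s + ε := by
  obtain ⟨δ, hδ, h⟩ := Metric.continuousAt_iff.mp (hf.continuousAt (x := (0 : ℝ))) ε hε
  obtain ⟨k, hk⟩ := pow_unbounded_of_one_lt (2 / δ) (one_lt_two (α := ℝ))
  refine ⟨k, fun s hs hs1 => ?_⟩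
  by_cases hsd : s < δ
  · have := h (x := s) (by simpa [abs_of_nonneg hs] using hsd)
    rw [h0, Real.dist_eq, sub_zero, abs_lt] at this
    linarith [this.2, cut_nonneg k s]
  · rw [cut_eq_one]
    · linarith
    · rw [div_lt_iff₀ hδ] at hk
      calc (2 : ℝ) ≤ 2 ^ k * δ := hk.le
        _ ≤ _ := by gcongr; linarith

section Trace

variable {B C E : Type*} [CStarAlgebra B] [PartialOrder B] [StarOrderedRing B]
  [CStarAlgebra C] [PartialOrder C] [StarOrderedRing C]
  [CStarAlgebra E] [PartialOrder E] [StarOrderedRing E]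
  {t : B →L[ℝ] ℝ} {s : C →L[ℝ] ℝ} {r : E →L[ℝ] ℝ}

theorem IsPosTrace.mono (ht : IsPosTrace t) {a b : B} (h : a ≤ b) : t a ≤ t b := by
  have := ht.nonneg (b - a) (sub_nonneg.mpr h)
  rw [map_sub] at this
  linarith

/-- The rank of `a` with respect to a trace, as a supremum of values on elements dominated by the
support of `a`. -/
noncomputable def dim (t : B →L[ℝ] ℝ) (a : B) : ℝ := ⨆ k, t (cfc (cut k) a)

theorem spectrum_nonneg {a : B} (ha : 0 ≤ a) {x : ℝ} (hx : x ∈ spectrum ℝ a) : 0 ≤ x :=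
  spectrum_nonneg_of_nonneg ha hx

theorem cfc_cut_le_one (k : ℕ) (a : B) : cfc (cut k) a ≤ 1 :=
  cfc_le_one _ _ fun _ _ => cut_le_one _ _

theorem cfc_cut_nonneg (k : ℕ) (a : B) : 0 ≤ cfc (cut k) a :=
  cfc_nonneg fun _ _ => cut_nonneg _ _

theorem cfc_cut_mono {a : B} (ha : 0 ≤ a) : Monotone fun k => cfc (cut k) a := fun _ _ h =>
  cfc_mono (fun _ hx => cut_mono h (spectrum_nonneg ha hx)) (continuous_cut _).continuousOn
    (continuous_cut _).continuousOn

theorem IsPosTrace.bddAbove (ht : IsPosTrace t) (a : B) :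
    BddAbove (Set.range fun k => t (cfc (cut k) a)) :=
  ⟨t 1, by rintro _ ⟨k, rfl⟩; exact ht.mono (cfc_cut_le_one k a)⟩

theorem IsPosTrace.cut_le_dim (ht : IsPosTrace t) (a : B) (k : ℕ) :
    t (cfc (cut k) a) ≤ dim t a := le_ciSup (ht.bddAbove a) k

theorem IsPosTrace.dim_nonneg (ht : IsPosTrace t) (a : B) : 0 ≤ dim t a :=
  (ht.nonneg _ (cfc_cut_nonneg 0 a)).trans (ht.cut_le_dim a 0)

theorem IsPosTrace.tendsto_cut (ht : IsPosTrace t) {a : B} (ha : 0 ≤ a) :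
    Tendsto (fun k => t (cfc (cut k) a)) atTop (𝓝 (dim t a)) :=
  tendsto_atTop_ciSup (fun _ _ h => ht.mono (cfc_cut_mono ha h)) (ht.bddAbove a)

theorem IsPosTrace.le_dim (ht : IsPosTrace t) {a : B} (ha : 0 ≤ a) {f : ℝ → ℝ}
    (hf : Continuous f) (h0 : f 0 = 0) (h1 : ∀ x ∈ spectrum ℝ a, f x ≤ 1) :
    t (cfc f a) ≤ dim t a := by
  refine le_of_forall_pos_le_add fun ε hε => ?_
  have h1' : 0 ≤ t 1 := ht.nonneg _ zero_le_one
  obtain ⟨k, hk⟩ := exists_le_cut_add hf h0 (ε := ε / (t 1 + 1)) (by positivity)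
  have h2 : cfc f a ≤ cfc (cut k) a + (ε / (t 1 + 1)) • (1 : B) := by
    have hc := continuous_cut k
    have : cfc (cut k) a + (ε / (t 1 + 1)) • (1 : B)
        = cfc (fun x => cut k x + ε / (t 1 + 1)) a := by
      rw [cfc_add_const _ _ _ hc.continuousOn, Algebra.algebraMap_eq_smul_one]
    rw [this]
    exact cfc_mono fun x hx => hk x (spectrum_nonneg ha hx) (h1 x hx)
  have h3 := ht.mono h2
  rw [map_add, map_smul, smul_eq_mul] at h3
  have h4 : ε / (t 1 + 1) * t 1 ≤ ε := by
    rw [div_mul_eq_mul_div, div_le_iff₀ (by positivity)]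
    nlinarith
  linarith [ht.cut_le_dim a k]

theorem IsPosTrace.apply_le_dim (ht : IsPosTrace t) {a : B} (ha : 0 ≤ a) (h1 : a ≤ 1) :
    t a ≤ dim t a := by
  conv_lhs => rw [← cfc_id ℝ a]
  refine ht.le_dim ha continuous_id rfl fun x hx => ?_
  exact (le_algebraMap_iff_spectrum_le (r := (1 : ℝ))).mp (by simpa using h1) x hx

theorem IsPosTrace.dim_cfc_le (ht : IsPosTrace t) {a : B} (ha : 0 ≤ a) {f : ℝ → ℝ}
    (hf : Continuous f) (h0 : f 0 = 0) : dim t (cfc f a) ≤ dim t a := by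
  refine ciSup_le fun k => ?_
  rw [← cfc_comp (cut k) f a (hg := (continuous_cut k).continuousOn)]
  exact ht.le_dim ha ((continuous_cut k).comp hf) (by simp [h0, cut_zero])
    fun x _ => cut_le_one _ _

theorem IsPosTrace.dim_smul_le (ht : IsPosTrace t) {a : B} (ha : 0 ≤ a) (c : ℝ) :
    dim t (c • a) ≤ dim t a := by
  conv_lhs => rw [← cfc_id ℝ a, ← cfc_smul c id a]
  exact ht.dim_cfc_le ha (by fun_prop) (by simp)

theorem IsPosTrace.dim_smul (ht : IsPosTrace t) {a : B} (ha : 0 ≤ a) {c : ℝ} (hc : 0 < c) :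
    dim t (c • a) = dim t a := by
  refine (ht.dim_smul_le ha c).antisymm ?_
  have := ht.dim_smul_le (smul_nonneg hc.le ha) c⁻¹
  rwa [smul_smul, inv_mul_cancel₀ hc.ne', one_smul] at this

theorem continuous_rpow_one_div {k : ℕ} (hk : 0 < k) :
    Continuous fun x : ℝ => x ^ (1 / (k : ℝ)) :=
  continuous_id.rpow_const fun _ => Or.inr (by positivity)

theorem tendsto_rpow_one_div {c : ℝ} (hc : 0 < c) :
    Tendsto (fun k : ℕ => c ^ (1 / (k : ℝ))) atTop (𝓝 1) := by
  have h := (Real.continuousAt_const_rpow hc.ne' (b := 0)).tendsto.comp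
    tendsto_one_div_atTop_nhds_zero_nat
  simpa [Function.comp_def] using h

/-- Links `dim` to the definition of `d_τ` by roots. With `M = ‖a‖ + 1`, the bounds `x^{1/k} ≤
M^{1/k}` and `cut j x ≤ (2^j x)^{1/k}` squeeze the limit, since both constants tend to `1`. -/
theorem IsPosTrace.tendsto_root (ht : IsPosTrace t) {a : B} (ha : 0 ≤ a) :
    Tendsto (fun k : ℕ => t (root k a)) atTop (𝓝 (dim t a)) := by
  have hM : 0 < ‖a‖ + 1 := by positivity
  have hupper : ∀ k : ℕ, 0 < k → t (root k a) ≤ (‖a‖ + 1) ^ (1 / (k : ℝ)) * dim t a := by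
    intro k hk
    have hc := continuous_rpow_one_div hk
    have hp : 0 < (‖a‖ + 1) ^ (1 / (k : ℝ)) := by positivity
    have h := ht.le_dim ha (f := fun x => ((‖a‖ + 1) ^ (1 / (k : ℝ)))⁻¹ * x ^ (1 / (k : ℝ)))
      (by fun_prop) (by simp [hk.ne']) (fun x hx => by
        rw [inv_mul_le_iff₀ hp, mul_one]
        have h0 := spectrum_nonneg ha hx
        have h1 := abs_le_norm_of_mem_spectrum hx
        rw [abs_of_nonneg h0] at h1
        exact Real.rpow_le_rpow h0 (by linarith) (by positivity))
    rw [cfc_const_mul _ _ _ hc.continuousOn, map_smul, smul_eq_mul, inv_mul_le_iff₀ hp] at h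
    exact h
  have hlower : ∀ j k : ℕ, 0 < k →
      t (cfc (cut j) a) ≤ ((2 : ℝ) ^ j) ^ (1 / (k : ℝ)) * t (root k a) := by
    intro j k hk
    have hc := continuous_rpow_one_div hk
    have h : cfc (cut j) a ≤ ((2 : ℝ) ^ j) ^ (1 / (k : ℝ)) • root k a := by
      rw [root, ← cfc_smul _ _ _ hc.continuousOn]
      refine cfc_mono (fun x hx => ?_) (continuous_cut j).continuousOn (by fun_prop)
      have h0 := spectrum_nonneg ha hx
      rw [smul_eq_mul, ← Real.mul_rpow (by positivity) h0]
      rcases le_total (2 ^ j * x) 1 with h1 | h1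
      · rw [cut_eq_zero h1]; positivity
      · exact (cut_le_one _ _).trans (Real.one_le_rpow h1 (by positivity))
    simpa using ht.mono h
  rw [tendsto_order]
  constructor
  · intro b hb
    obtain ⟨j, hj⟩ := exists_lt_of_lt_ciSup hb
    have h1 := ((tendsto_rpow_one_div (c := 2 ^ j) (by positivity)).mul_const b)
    rw [one_mul] at h1
    filter_upwards [h1.eventually_lt_const hj, eventually_gt_atTop 0] with k hk hk0
    have := hk.trans_le (hlower j k hk0)
    exact lt_of_mul_lt_mul_left this (by positivity)
  · intro b hb
    have h1 := ((tendsto_rpow_one_div hM).mul_const (dim t a))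
    rw [one_mul] at h1
    filter_upwards [h1.eventually_lt_const hb, eventually_gt_atTop 0] with k hk hk0
    exact (hupper k hk0).trans_lt hk

/-- Uses the description by roots: `x ↦ x^{1/k}` is operator monotone, the cut-offs are not. -/
theorem IsPosTrace.dim_mono (ht : IsPosTrace t) {a b : B} (ha : 0 ≤ a) (hab : a ≤ b) :
    dim t a ≤ dim t b := by
  have hb := ha.trans hab
  refine le_of_tendsto_of_tendsto (ht.tendsto_root ha) (ht.tendsto_root hb) ?_
  filter_upwards [eventually_gt_atTop 0] with k hk
  refine ht.mono ?_
  rw [root, root, ← CFC.rpow_eq_cfc_real ha, ← CFC.rpow_eq_cfc_real hb]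
  refine CFC.rpow_le_rpow ⟨by positivity, ?_⟩ hab
  rw [div_le_one (by positivity)]
  exact_mod_cast hk

/-- Positive moments determine the traces of all `f` vanishing at `0`. The three algebras may
differ, so this serves block sums as well as `w w*` against `w* w` for rectangular `w`. -/
theorem apply_cfc_eq_add_of_apply_pow (f : ℝ → ℝ) (hf : Continuous f) (h0 : f 0 = 0)
    {a : B} {c : C} {e : E} (ha : IsSelfAdjoint a) (hc : IsSelfAdjoint c) (he : IsSelfAdjoint e)
    (h : ∀ n : ℕ, t (a ^ (n + 1)) = s (c ^ (n + 1)) + r (e ^ (n + 1))) :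
    t (cfc f a) = s (cfc f c) + r (cfc f e) := by
  have hpoly : ∀ p : Polynomial ℝ, t (Polynomial.aeval a (Polynomial.X * p))
      = s (Polynomial.aeval c (Polynomial.X * p))
        + r (Polynomial.aeval e (Polynomial.X * p)) := by
    intro p
    induction p using Polynomial.induction_on' with
    | add p q hp hq => simp only [mul_add, map_add, hp, hq]; ring
    | monomial n x =>
      rw [Polynomial.X_mul_monomial]
      simp only [Polynomial.aeval_monomial, ← Algebra.smul_def, map_smul, h, smul_eq_mul]
      ring
  rw [← sub_eq_zero, ← norm_le_zero_iff]
  refine le_of_forall_pos_le_add fun ε hε => ?_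
  set K := ‖t‖ + ‖s‖ + ‖r‖ + 1
  have hK : 0 < K := by positivity
  obtain ⟨p, hp⟩ := exists_polynomial_mul_near hf h0 (max ‖a‖ (max ‖c‖ ‖e‖)) (ε := ε / K)
    (by positivity)
  have h1 := norm_aeval_sub_cfc_le hf (by positivity) hp ha (by simp)
  have h2 := norm_aeval_sub_cfc_le hf (by positivity) hp hc (by simp)
  have h3 := norm_aeval_sub_cfc_le hf (by positivity) hp he (by simp)
  have h4 := hpoly p
  have e1 := (t.le_opNorm_of_le h1)
  have e2 := (s.le_opNorm_of_le h2)
  have e3 := (r.le_opNorm_of_le h3)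
  rw [map_sub, Real.norm_eq_abs, abs_le] at e1 e2 e3
  have e4 : ‖t‖ * (ε / K) + ‖s‖ * (ε / K) + ‖r‖ * (ε / K) ≤ ε := by
    rw [← add_mul, ← add_mul, mul_div_assoc', div_le_iff₀ hK, mul_comm]
    gcongr
    simp [K]
  rw [Real.norm_eq_abs, zero_add, abs_le]
  constructor <;> linarith [e1.1, e1.2, e2.1, e2.2, e3.1, e3.2]

theorem dim_eq_add_of_apply_pow (ht : IsPosTrace t) (hs : IsPosTrace s) (hr : IsPosTrace r)
    {a : B} {c : C} {e : E} (ha : 0 ≤ a) (hc : 0 ≤ c) (he : 0 ≤ e)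
    (h : ∀ n : ℕ, t (a ^ (n + 1)) = s (c ^ (n + 1)) + r (e ^ (n + 1))) :
    dim t a = dim s c + dim r e := by
  refine tendsto_nhds_unique (ht.tendsto_cut ha)
    (((hs.tendsto_cut hc).add (hr.tendsto_cut he)).congr fun k => ?_)
  exact (apply_cfc_eq_add_of_apply_pow _ (continuous_cut k) (cut_zero k) (.of_nonneg ha)
    (.of_nonneg hc) (.of_nonneg he) h).symm

theorem apply_cfc_eq_of_apply_pow (f : ℝ → ℝ) (hf : Continuous f) (h0 : f 0 = 0)
    {a : B} {c : C} (ha : IsSelfAdjoint a) (hc : IsSelfAdjoint c)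
    (h : ∀ n : ℕ, t (a ^ (n + 1)) = s (c ^ (n + 1))) : t (cfc f a) = s (cfc f c) := by
  simpa using apply_cfc_eq_add_of_apply_pow (r := (0 : C →L[ℝ] ℝ)) f hf h0 ha hc hc
    (by simpa using h)

theorem dim_cfc_eq_of_apply_pow (f : ℝ → ℝ) (hf : Continuous f) (h0 : f 0 = 0)
    {a : B} {c : C} (ha : IsSelfAdjoint a) (hc : IsSelfAdjoint c)
    (h : ∀ n : ℕ, t (a ^ (n + 1)) = s (c ^ (n + 1))) : dim t (cfc f a) = dim s (cfc f c) := by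
  refine iSup_congr fun k => ?_
  have hk := continuous_cut k
  rw [← cfc_comp (cut k) f a (hg := hk.continuousOn), ← cfc_comp (cut k) f c (hg := hk.continuousOn)]
  exact apply_cfc_eq_of_apply_pow _ (hk.comp hf) (by simp [h0, cut_zero]) ha hc h

theorem dim_eq_of_apply_pow {a : B} {c : C} (ha : IsSelfAdjoint a) (hc : IsSelfAdjoint c)
    (h : ∀ n : ℕ, t (a ^ (n + 1)) = s (c ^ (n + 1))) : dim t a = dim s c :=
  iSup_congr fun k =>
    apply_cfc_eq_of_apply_pow _ (continuous_cut k) (cut_zero k) ha hc h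

theorem IsPosTrace.dim_mul_star (ht : IsPosTrace t) (x : B) :
    dim t (x * star x) = dim t (star x * x) := by
  refine dim_eq_of_apply_pow (.mul_star_self x) (.star_mul_self x) fun n => ?_
  have : ∀ n : ℕ, (x * star x) ^ (n + 1) = x * (star x * x) ^ n * star x := by
    intro n
    induction n with
    | zero => simp
    | succ n ih => rw [pow_succ, ih, pow_succ (star x * x)]; simp only [mul_assoc]
  rw [this, ht.comm, ← mul_assoc, ← pow_succ']

theorem IsPosTrace.dim_add_of_mul_eq_zero (ht : IsPosTrace t) {a b : B} (ha : 0 ≤ a) (hb : 0 ≤ b)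
    (hab : a * b = 0) : dim t (a + b) = dim t a + dim t b := by
  have hba : b * a = 0 := by
    have := congrArg star hab
    rwa [star_mul, star_zero, (IsSelfAdjoint.of_nonneg ha).star_eq,
      (IsSelfAdjoint.of_nonneg hb).star_eq] at this
  refine dim_eq_add_of_apply_pow ht ht ht (add_nonneg ha hb) ha hb fun n => ?_
  rw [← map_add]
  congr 1
  induction n with
  | zero => simp
  | succ n ih =>
    rw [pow_succ, ih, add_mul, mul_add, mul_add, pow_succ a n, mul_assoc _ a b, hab,
      pow_succ b n, mul_assoc _ b a, hba, ← pow_succ a, ← pow_succ b, pow_succ a (n + 1),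
      pow_succ b (n + 1)]
    simp

/-- With `e = cut k (a)`, the norm bound gives `a - 2⁻ᵏ ≤ b`, hence `e³ ≤ 2ᵏ e b e`. Now `e` and
`e³` have the same rank, and `e b e` has rank at most that of `b`. -/
theorem IsPosTrace.dim_cfc_cut_le_of_norm_sub_le (ht : IsPosTrace t) {a b : B}
    (hasa : IsSelfAdjoint a) (hb : 0 ≤ b) {k : ℕ} (h : ‖a - b‖ ≤ (2 ^ k)⁻¹) : dim t (cfc (cut k) a) ≤ dim t b := by
  have hc := continuous_cut k
  set e := cfc (cut k) a with he
  have he0 : 0 ≤ e := cfc_cut_nonneg k a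
  have hes : star e = e := (IsSelfAdjoint.of_nonneg he0).star_eq
  have hbsa : IsSelfAdjoint b := .of_nonneg hb
  have h1 : a - algebraMap ℝ B (2 ^ k)⁻¹ ≤ b := by
    have h2 := (hasa.sub hbsa).le_algebraMap_norm_self
    have h3 : algebraMap ℝ B ‖a - b‖ ≤ algebraMap ℝ B (2 ^ k)⁻¹ := algebraMap_mono B h
    have h4 := h2.trans h3
    rw [sub_le_iff_le_add] at h4 ⊢
    rwa [add_comm]
  have h2 : cfc (fun x => cut k x ^ 3) a ≤ (2 : ℝ) ^ k • (e * b * e) := by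
    have h3 : cfc (fun x => cut k x ^ 3) a
        ≤ (2 : ℝ) ^ k • (e * (a - algebraMap ℝ B (2 ^ k)⁻¹) * e) := by
      have h4 : (2 : ℝ) ^ k • (e * (a - algebraMap ℝ B (2 ^ k)⁻¹) * e)
          = cfc (fun x => (2 : ℝ) ^ k * (cut k x * (x - (2 ^ k)⁻¹) * cut k x)) a := by
        rw [cfc_const_mul _ _ _ (by fun_prop), cfc_mul _ _ _ (by fun_prop) (by fun_prop),
          cfc_mul _ _ _ (by fun_prop) (by fun_prop), cfc_sub _ _ _ (by fun_prop) (by fun_prop),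
          cfc_id' ℝ a, cfc_const _ a]
      rw [h4]
      exact cfc_mono fun x _ => cut_pow_three_le k x
    refine h3.trans (smul_le_smul_of_nonneg_left ?_ (by positivity))
    simpa [hes] using star_left_conjugate_le_conjugate h1 e
  have hroot : e = cfc (fun x : ℝ => x ^ (1 / ((3 : ℕ) : ℝ))) (cfc (fun x => cut k x ^ 3) a) := by
    rw [← cfc_comp (fun x : ℝ => x ^ (1 / ((3 : ℕ) : ℝ))) (fun x => cut k x ^ 3) a
      (hg := (continuous_rpow_one_div (by norm_num)).continuousOn)]
    refine cfc_congr fun x _ => ?_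
    simp only [Function.comp]
    rw [one_div, Real.pow_rpow_inv_natCast (cut_nonneg k x) (by norm_num)]
  have hnn : 0 ≤ cfc (fun x => cut k x ^ 3) a :=
    cfc_nonneg fun x _ => pow_nonneg (cut_nonneg k x) 3
  have hebe : 0 ≤ e * b * e := by simpa [hes] using star_left_conjugate_nonneg hb e
  calc dim t e ≤ dim t (cfc (fun x => cut k x ^ 3) a) := by
        conv_lhs => rw [hroot]
        exact ht.dim_cfc_le hnn (continuous_rpow_one_div (by norm_num)) (by simp)
    _ ≤ dim t ((2 : ℝ) ^ k • (e * b * e)) := ht.dim_mono hnn h2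
    _ ≤ dim t (e * b * e) := ht.dim_smul_le hebe _
    -- For `b = x* x`, the rank of `(x e)* (x e)` is that of `x e² x*`, and `x e² x* ≤ x x*`.
    _ ≤ dim t b := by
        obtain ⟨x, rfl⟩ := exists_eq_star_mul_self hb
        have h5 : e * (star x * x) * e = star (x * e) * (x * e) := by
          rw [star_mul, hes]; simp only [mul_assoc]
        rw [h5, ← ht.dim_mul_star, ← ht.dim_mul_star x]
        refine ht.dim_mono (mul_star_self_nonneg _) ?_
        have h6 : x * e * star (x * e) = x * (e * e) * star x := by
          rw [star_mul, hes]; simp only [mul_assoc]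
        have h7 : e * e ≤ 1 := by
          rw [he, ← cfc_mul (cut k) (cut k) a]
          exact cfc_le_one _ _ fun x _ => mul_le_one₀ (cut_le_one k x) (cut_nonneg k x)
            (cut_le_one k x)
        rw [h6]
        simpa using star_right_conjugate_le_conjugate h7 x

/-- Rank is lower semicontinuous in norm, being a supremum of the norm-continuous maps `t (cut k
(·))`. -/
theorem IsPosTrace.dim_le_of_tendsto (ht : IsPosTrace t) {u : ℕ → B} {a : B} (hu : ∀ k, 0 ≤ u k)
    (ha : 0 ≤ a) (h : Tendsto u atTop (𝓝 a)) {c : ℝ} (hc : ∀ k, dim t (u k) ≤ c) :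
    dim t a ≤ c :=
  ciSup_le fun k => le_of_tendsto ((t.continuous.tendsto _).comp
    (tendsto_cfc_of_tendsto (continuous_cut k) (fun j => .of_nonneg (hu j)) (.of_nonneg ha) h))
    (Eventually.of_forall fun j => (ht.cut_le_dim (u j) k).trans (hc j))

/-- The weights `2⁻ᵏ` force norm convergence without changing ranks. Partial sums have additive rank
by orthogonality; monotonicity and lower semicontinuity pass to the limit. One `y` serves all
traces. -/
theorem exists_hasSum_dim {z : ℕ → B} (h0 : ∀ k, 0 ≤ z k) (h1 : ∀ k, z k ≤ 1)
    (hz : ∀ k l, k < l → z k * z l = 0) :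
    ∃ y : B, 0 ≤ y ∧ ∀ t : B →L[ℝ] ℝ, IsPosTrace t → HasSum (fun k => dim t (z k)) (dim t y) := by
  have hsum : Summable fun k => ((2 : ℝ)⁻¹ ^ k) • z k := by
    refine Summable.of_norm_bounded (g := fun k => (2 : ℝ)⁻¹ ^ k)
      (summable_geometric_of_lt_one (by norm_num) (by norm_num)) fun k => ?_
    rw [norm_smul, Real.norm_of_nonneg (by positivity)]
    have : ‖z k‖ ≤ 1 := CStarAlgebra.norm_le_one_iff_of_nonneg (z k) (h0 k) |>.mpr (h1 k)
    exact mul_le_of_le_one_right (by positivity) this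
  have hw : ∀ k, 0 ≤ ((2 : ℝ)⁻¹ ^ k) • z k := fun k => smul_nonneg (by positivity) (h0 k)
  refine ⟨∑' k, ((2 : ℝ)⁻¹ ^ k) • z k, tsum_nonneg hw, fun t ht => ?_⟩
  set u : ℕ → B := fun K => ∑ k ∈ Finset.range K, ((2 : ℝ)⁻¹ ^ k) • z k
  have hu0 : ∀ K, 0 ≤ u K := fun K => Finset.sum_nonneg fun k _ => hw k
  have hdim : ∀ K, dim t (u K) = ∑ k ∈ Finset.range K, dim t (z k) := by
    intro K
    induction K with
    | zero =>
      have : ∀ k, cfc (cut k) (0 : B) = 0 := fun k => by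
        have := cfc_mul_eq_zero (b := (1 : B)) (continuous_cut k) (cut_zero k)
          (IsSelfAdjoint.zero B) (zero_mul 1)
        simpa using this
      simp [u, dim, this]
    | succ K ih =>
      have h2 : u (K + 1) = u K + ((2 : ℝ)⁻¹ ^ K) • z K := Finset.sum_range_succ _ _
      rw [h2, ht.dim_add_of_mul_eq_zero (hu0 K) (hw K), ih, Finset.sum_range_succ,
        ht.dim_smul (h0 K) (by positivity)]
      rw [Finset.sum_mul]
      refine Finset.sum_eq_zero fun k hk => ?_
      rw [smul_mul_smul_comm, hz k K (Finset.mem_range.mp hk), smul_zero]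
  rw [hasSum_iff_tendsto_nat_of_nonneg fun k => ht.dim_nonneg _]
  have hmono : Monotone fun K => ∑ k ∈ Finset.range K, dim t (z k) := fun K L hKL =>
    Finset.sum_le_sum_of_subset_of_nonneg (Finset.range_mono hKL) fun k _ _ => ht.dim_nonneg _
  have hle : ∀ K, ∑ k ∈ Finset.range K, dim t (z k) ≤ dim t (∑' k, ((2 : ℝ)⁻¹ ^ k) • z k) :=
    fun K => by
      rw [← hdim]
      exact ht.dim_mono (hu0 K) (hsum.sum_le_tsum _ fun k _ => hw k)
  have hb : BddAbove (Set.range fun K => ∑ k ∈ Finset.range K, dim t (z k)) :=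
    ⟨_, by rintro _ ⟨K, rfl⟩; exact hle K⟩
  have heq : dim t (∑' k, ((2 : ℝ)⁻¹ ^ k) • z k)
      = ⨆ K, ∑ k ∈ Finset.range K, dim t (z k) := by
    refine le_antisymm ?_ (ciSup_le hle)
    exact ht.dim_le_of_tendsto hu0 (tsum_nonneg hw) hsum.hasSum.tendsto_sum_nat fun K => by
      rw [hdim]; exact le_ciSup hb K
  rw [heq]
  exact tendsto_atTop_ciSup hmono hb

end Trace

/-! ### Traces on matrices: additivity, compactness of `T(A)`, faithfulness -/

section Matrices

variable {A : Type*} [CStarAlgebra A] [PartialOrder A] [StarOrderedRing A]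

/-- The real part of a bounded complex functional, as a bounded real functional. -/
noncomputable def realPartFunctional {B : Type*} [CStarAlgebra B] (T : B →L[ℂ] ℂ) : B →L[ℝ] ℝ :=
  Complex.reCLM.comp (ContinuousLinearMap.restrictScalars ℝ T)

/-- The trace on matrices induced by a tracial state, as a bounded real functional. -/
noncomputable def reTrace (τ : tracialStates A) (n : ℕ) :=
  realPartFunctional (B := CStarMatrix (Fin n) (Fin n) A)
    { toFun := fun a => ∑ i, (τ : WeakDual ℂ A) (a i i)
      map_add' := fun a b => by simp [Finset.sum_add_distrib]
      map_smul' := fun c a => by simp [Finset.mul_sum]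
      cont := by
        refine continuous_finsetSum _ fun i _ => (τ : WeakDual ℂ A).continuous.comp ?_
        exact (continuous_apply i).comp (continuous_apply i) }

theorem reTrace_apply (τ : tracialStates A) {n : ℕ} (a : CStarMatrix (Fin n) (Fin n) A) :
    reTrace τ n a = matrixTrace τ a := rfl

theorem matrixTrace_mul_comm (τ : tracialStates A) {m n : ℕ} (v : CStarMatrix (Fin m) (Fin n) A)
    (w : CStarMatrix (Fin n) (Fin m) A) : matrixTrace τ (v * w) = matrixTrace τ (w * v) := by
  simp only [matrixTrace, CStarMatrix.mul_apply, map_sum]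
  rw [Finset.sum_comm]
  simp only [τ.2.2.2]

theorem matrixTrace_star_mul_self (τ : tracialStates A) {n : ℕ}
    (x : CStarMatrix (Fin n) (Fin n) A) :
    matrixTrace τ (star x * x) = ∑ i, ∑ k, ((τ : WeakDual ℂ A) (star (x k i) * x k i)).re := by
  simp only [matrixTrace, CStarMatrix.mul_apply, map_sum, Complex.re_sum]
  rfl

theorem re_apply_star_mul_self_nonneg (τ : tracialStates A) (x : A) :
    0 ≤ ((τ : WeakDual ℂ A) (star x * x)).re :=
  (Complex.le_def.mp (τ.2.1 _ (star_mul_self_nonneg x))).1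

theorem isPosTrace_reTrace (τ : tracialStates A) (n : ℕ) : IsPosTrace (reTrace τ n) where
  nonneg a ha := by
    obtain ⟨x, rfl⟩ := exists_eq_star_mul_self ha
    rw [reTrace_apply, matrixTrace_star_mul_self]
    exact Finset.sum_nonneg fun i _ => Finset.sum_nonneg fun k _ =>
      re_apply_star_mul_self_nonneg τ _
  comm a b := matrixTrace_mul_comm τ a b

theorem dimFun_eq_dim (τ : tracialStates A) (a : PosMatrix A) :
    dimFun τ a = dim (reTrace τ a.size) a.mat :=
  ((isPosTrace_reTrace τ a.size).tendsto_root a.nonneg).limUnder_eq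

theorem blockSum_mul {m n : ℕ} (a a' : CStarMatrix (Fin m) (Fin m) A)
    (b b' : CStarMatrix (Fin n) (Fin n) A) :
    blockSum a b * blockSum a' b' = blockSum (a * a') (b * b') := by
  have h : ∀ (a a' : Matrix (Fin m) (Fin m) A) (b b' : Matrix (Fin n) (Fin n) A),
      (Matrix.fromBlocks a 0 0 b).reindex finSumFinEquiv finSumFinEquiv
        * (Matrix.fromBlocks a' 0 0 b').reindex finSumFinEquiv finSumFinEquiv
      = (Matrix.fromBlocks (a * a') 0 0 (b * b')).reindex finSumFinEquiv finSumFinEquiv := by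
    intro a a' b b'
    simp only [Matrix.reindex_apply, Matrix.submatrix_mul_equiv, Matrix.fromBlocks_multiply]
    simp
  exact h a a' b b'

theorem matrixTrace_blockSum (τ : tracialStates A) {m n : ℕ} (a : CStarMatrix (Fin m) (Fin m) A)
    (b : CStarMatrix (Fin n) (Fin n) A) :
    matrixTrace τ (blockSum a b) = matrixTrace τ a + matrixTrace τ b := by
  simp only [matrixTrace, ← Complex.add_re]
  rw [← finSumFinEquiv.sum_comp, Fintype.sum_sum_type]
  simp [blockSum, -finSumFinEquiv_apply_left, -finSumFinEquiv_apply_right]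

theorem dim_blockSum (τ : tracialStates A) {m n : ℕ} {a : CStarMatrix (Fin m) (Fin m) A}
    {b : CStarMatrix (Fin n) (Fin n) A} (ha : 0 ≤ a) (hb : 0 ≤ b) :
    dim (reTrace τ (m + n)) (blockSum a b) = dim (reTrace τ m) a + dim (reTrace τ n) b := by
  refine dim_eq_add_of_apply_pow (isPosTrace_reTrace _ _) (isPosTrace_reTrace _ _)
    (isPosTrace_reTrace _ _) (blockSum_nonneg ha hb) ha hb fun k => ?_
  have : blockSum a b ^ (k + 1) = blockSum (a ^ (k + 1)) (b ^ (k + 1)) := by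
    induction k with
    | zero => simp
    | succ k ih => rw [pow_succ, ih, blockSum_mul, ← pow_succ, ← pow_succ]
  rw [this]
  exact matrixTrace_blockSum τ _ _

theorem dimFun_add (τ : tracialStates A) (a b : PosMatrix A) :
    dimFun τ (a + b) = dimFun τ a + dimFun τ b := by
  simp only [dimFun_eq_dim]
  exact dim_blockSum τ a.nonneg b.nonneg

theorem matrixTrace_pow_mul_conjTranspose (τ : tracialStates A) {m n : ℕ}
    (w : CStarMatrix (Fin m) (Fin n) A) (k : ℕ) :
    matrixTrace τ ((w * w.conjTranspose) ^ (k + 1))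
      = matrixTrace τ ((w.conjTranspose * w) ^ (k + 1)) := by
  have h : ∀ w : Matrix (Fin m) (Fin n) A,
      (w * w.conjTranspose) ^ (k + 1)
        = w * ((w.conjTranspose * w) ^ k * w.conjTranspose) := by
    intro w
    induction k with
    | zero => simp
    | succ k ih =>
      rw [pow_succ, ih, pow_succ (w.conjTranspose * w)]
      simp only [Matrix.mul_assoc]
  have h' : ∀ w : Matrix (Fin m) (Fin n) A,
      (w.conjTranspose * w) ^ k * w.conjTranspose * w = (w.conjTranspose * w) ^ (k + 1) := by
    intro w
    rw [pow_succ, Matrix.mul_assoc]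
  have e1 : (w * w.conjTranspose) ^ (k + 1)
      = w * ((w.conjTranspose * w) ^ k * w.conjTranspose) := h w
  have e2 : (w.conjTranspose * w) ^ k * w.conjTranspose * w
      = (w.conjTranspose * w) ^ (k + 1) := h' w
  rw [e1, matrixTrace_mul_comm, e2]

theorem isSelfAdjoint_mul_conjTranspose {m n : ℕ} (w : CStarMatrix (Fin m) (Fin n) A) :
    IsSelfAdjoint (w * w.conjTranspose) := by
  have h : ∀ w : Matrix (Fin m) (Fin n) A,
      (w * w.conjTranspose).conjTranspose = w * w.conjTranspose := by
    intro w
    rw [Matrix.conjTranspose_mul, Matrix.conjTranspose_conjTranspose]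
  exact h w

theorem isSelfAdjoint_conjTranspose_mul {m n : ℕ} (w : CStarMatrix (Fin m) (Fin n) A) :
    IsSelfAdjoint (w.conjTranspose * w) := by
  have h : ∀ w : Matrix (Fin m) (Fin n) A,
      (w.conjTranspose * w).conjTranspose = w.conjTranspose * w := by
    intro w
    rw [Matrix.conjTranspose_mul, Matrix.conjTranspose_conjTranspose]
  exact h w

theorem continuous_matrixTrace {n : ℕ} (a : CStarMatrix (Fin n) (Fin n) A) :
    Continuous fun τ : tracialStates A => matrixTrace τ a :=
  Complex.continuous_re.comp (continuous_finsetSum _ fun i _ =>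
    (WeakDual.eval_continuous (a i i)).comp continuous_subtype_val)

theorem matrixTrace_mem_aff {n : ℕ} (a : CStarMatrix (Fin n) (Fin n) A) (c : ℝ) :
    (⟨fun τ => matrixTrace τ a / c, (continuous_matrixTrace a).div_const c⟩ :
      C(tracialStates A, ℝ)) ∈ Aff A := by
  intro ρ σ τ x y _ _ _ h
  have h1 : matrixTrace ρ a = x * matrixTrace σ a + y * matrixTrace τ a := by
    simp only [matrixTrace, h]
    have : ∀ i, ((x : ℂ) • (σ : WeakDual ℂ A) + (y : ℂ) • (τ : WeakDual ℂ A)) (a i i)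
        = (x : ℂ) * (σ : WeakDual ℂ A) (a i i) + (y : ℂ) * (τ : WeakDual ℂ A) (a i i) :=
      fun i => rfl
    simp only [this, Finset.sum_add_distrib, ← Finset.mul_sum, Complex.add_re,
      Complex.re_ofReal_mul]
  simp only [ContinuousMap.coe_mk, h1]
  ring

/-- The `4` counts the positive parts of `a`. Any uniform bound is enough for Banach–Alaoglu. -/
theorem norm_apply_le_of_mem_tracialStates {τ : WeakDual ℂ A} (hτ : τ ∈ tracialStates A) (a : A) :
    ‖τ a‖ ≤ 4 * ‖a‖ := by
  have hpos : ∀ x : A, 0 ≤ x → ‖τ x‖ ≤ ‖x‖ := by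
    intro x hx
    have h1 := hτ.1 x hx
    have h2 := hτ.1 _ (sub_nonneg.mpr (IsSelfAdjoint.of_nonneg hx).le_algebraMap_norm_self)
    have h3 : algebraMap ℝ A ‖x‖ = (‖x‖ : ℂ) • (1 : A) := by
      rw [Algebra.algebraMap_eq_smul_one, Complex.coe_smul]
    rw [map_sub, sub_nonneg, h3, map_smul, hτ.2.1, smul_eq_mul, mul_one] at h2
    have h4 := CStarAlgebra.norm_le_norm_of_nonneg_of_le h1 h2
    simpa using h4
  obtain ⟨y, hy, hn, h⟩ := CStarAlgebra.exists_sum_four_nonneg a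
  conv_lhs => rw [h]
  rw [map_sum]
  refine (norm_sum_le_of_le (f := fun i : Fin 4 => τ (Complex.I ^ (i : ℕ) • y i))
    (n := fun _ => ‖a‖) Finset.univ fun i _ => ?_).trans (by simp)
  rw [map_smul, norm_smul]
  simpa using (hpos _ (hy i)).trans (hn i)

theorem isCompact_tracialStates : IsCompact (tracialStates A) := by
  refine IsCompact.of_isClosed_subset (WeakDual.isCompact_closedBall (𝕜 := ℂ) (E := A) 0 4) ?_ ?_
  · have h : tracialStates A = (⋂ a : A, ⋂ (_ : 0 ≤ a), {τ : WeakDual ℂ A | 0 ≤ τ a})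
        ∩ ({τ : WeakDual ℂ A | τ 1 = 1}
        ∩ ⋂ a : A, ⋂ b : A, {τ : WeakDual ℂ A | τ (a * b) = τ (b * a)}) := by
      ext τ
      simp [tracialStates]
    rw [h]
    refine IsClosed.inter (isClosed_iInter fun a => isClosed_iInter fun _ => ?_)
      (IsClosed.inter ?_ (isClosed_iInter fun a => isClosed_iInter fun b => ?_))
    · exact isClosed_le continuous_const (WeakDual.eval_continuous a)
    · exact isClosed_eq (WeakDual.eval_continuous _) continuous_const
    · exact isClosed_eq (WeakDual.eval_continuous _) (WeakDual.eval_continuous _)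
  · intro τ hτ
    simp only [Set.mem_preimage, Metric.mem_closedBall, dist_zero_right]
    exact ContinuousLinearMap.opNorm_le_bound _ (by norm_num)
      (norm_apply_le_of_mem_tracialStates hτ)

instance : CompactSpace (tracialStates A) := isCompact_iff_compactSpace.mp isCompact_tracialStates

/-- The left kernel of a tracial state, which is a closed two-sided ideal. -/
def traceKernel (τ : tracialStates A) : TwoSidedIdeal A :=
  TwoSidedIdeal.mk' {x | ((τ : WeakDual ℂ A) (star x * x)).re = 0}
    (by simp)
    (by
      intro x y hx hy
      refine le_antisymm ?_ (re_apply_star_mul_self_nonneg τ _)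
      have h := re_apply_star_mul_self_nonneg τ (x - y)
      -- Parallelogram identity: the trace of the right side is zero and both terms on the left have
      -- nonnegative trace.
      have e : star (x + y) * (x + y) + star (x - y) * (x - y)
          = (star x * x + star y * y) + (star x * x + star y * y) := by
        simp only [star_add, star_sub]; noncomm_ring
      have e' := congrArg (fun z => ((τ : WeakDual ℂ A) z).re) e
      simp only [map_add, Complex.add_re] at e'
      simp only [Set.mem_ofPred_eq] at hx hy
      linarith)
    (by intro x hx; simpa using hx)
    (by
      intro x y hy
      refine le_antisymm ?_ (re_apply_star_mul_self_nonneg τ _)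
      have h : star (x * y) * (x * y) ≤ ‖star x * x‖ • (star y * y) := by
        have := CStarAlgebra.star_left_conjugate_le_norm_smul (a := y) (b := star x * x)
        simpa only [star_mul, mul_assoc] using this
      have h1 := (Complex.le_def.mp (τ.2.1 _ (sub_nonneg.mpr h))).1
      rw [← Complex.coe_smul, map_sub, map_smul, smul_eq_mul, Complex.sub_re,
        Complex.re_ofReal_mul] at h1
      simp only [Set.mem_ofPred_eq] at hy
      rw [hy] at h1
      simpa using h1)
    (by
      intro x y hx
      simp only [Set.mem_ofPred_eq] at hx ⊢
      refine le_antisymm ?_ (re_apply_star_mul_self_nonneg τ _)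
      -- The trace property replaces `(x y)* (x y)` by `(x y)(x y)*`, where `y y*` sits inside and
      -- can be bounded by its norm.
      have h : star (star (x * y)) * star (x * y) ≤ ‖y * star y‖ • (x * star x) := by
        have := CStarAlgebra.star_right_conjugate_le_norm_smul (a := x) (b := y * star y)
        simpa only [star_mul, star_star, mul_assoc] using this
      have h1 := (Complex.le_def.mp (τ.2.1 _ (sub_nonneg.mpr h))).1
      rw [← Complex.coe_smul, map_sub, map_smul, smul_eq_mul, Complex.sub_re,
        Complex.re_ofReal_mul, star_star, τ.2.2.2 (x * y), τ.2.2.2 x, hx] at h1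
      simpa using h1)

theorem mem_traceKernel {τ : tracialStates A} {x : A} :
    x ∈ traceKernel τ ↔ ((τ : WeakDual ℂ A) (star x * x)).re = 0 :=
  TwoSidedIdeal.mem_mk' ..

theorem eq_zero_of_apply_star_mul_self (hA : IsSimpleCStar A) (τ : tracialStates A) {x : A}
    (hx : ((τ : WeakDual ℂ A) (star x * x)).re = 0) : x = 0 := by
  have hc : IsClosed (traceKernel τ : Set A) := by
    have : (traceKernel τ : Set A) = {x | ((τ : WeakDual ℂ A) (star x * x)).re = 0} := by
      ext x; exact mem_traceKernel
    rw [this]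
    refine isClosed_eq (Complex.continuous_re.comp ((τ : WeakDual ℂ A).continuous.comp ?_))
      continuous_const
    fun_prop
  rcases hA.2 _ hc with h | h
  · have := mem_traceKernel.mpr hx
    rwa [h, TwoSidedIdeal.mem_bot] at this
  · have : (1 : A) ∈ traceKernel τ := by rw [h]; trivial
    rw [mem_traceKernel] at this
    simp [τ.2.2.1] at this

theorem matrixTrace_pos (hA : IsSimpleCStar A) (τ : tracialStates A) {n : ℕ}
    {c : CStarMatrix (Fin n) (Fin n) A} (hc : 0 ≤ c) (h0 : c ≠ 0) : 0 < matrixTrace τ c := by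
  refine lt_of_le_of_ne ((isPosTrace_reTrace τ n).nonneg c hc) fun h => h0 ?_
  obtain ⟨x, rfl⟩ := exists_eq_star_mul_self hc
  rw [matrixTrace_star_mul_self, eq_comm, Finset.sum_eq_zero_iff_of_nonneg fun i _ =>
    Finset.sum_nonneg fun k _ => re_apply_star_mul_self_nonneg τ _] at h
  have hx : x = 0 := by
    ext k i
    have h1 := h i (Finset.mem_univ _)
    rw [Finset.sum_eq_zero_iff_of_nonneg fun k _ => re_apply_star_mul_self_nonneg τ _] at h1
    exact eq_zero_of_apply_star_mul_self hA τ (h1 k (Finset.mem_univ _))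
  rw [hx, mul_zero]

end Matrices

/-! ### Uniform bounds by compactness, and the bump decomposition -/

theorem exists_pos_forall_le {X : Type*} [TopologicalSpace X] [CompactSpace X] {f : X → ℝ}
    (hf : Continuous f) (h : ∀ x, 0 < f x) : ∃ η > 0, ∀ x, η ≤ f x := by
  rcases isEmpty_or_nonempty X with hX | hX
  · exact ⟨1, one_pos, fun x => isEmptyElim x⟩
  · obtain ⟨x, -, hx⟩ := isCompact_univ.exists_isMinOn Set.univ_nonempty hf.continuousOn
    exact ⟨f x, h x, fun y => hx (Set.mem_univ y)⟩

/-- Dini's argument: the open sets `{g < F j}` increase and cover a compact space. -/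
theorem exists_forall_lt_of_monotone {X : Type*} [TopologicalSpace X] [CompactSpace X] {g : X → ℝ}
    {F : ℕ → X → ℝ} (hg : Continuous g) (hF : ∀ j, Continuous (F j))
    (hmono : ∀ x, Monotone fun j => F j x) (h : ∀ x, ∃ j, g x < F j x) :
    ∃ j, ∀ x, g x < F j x := by
  obtain ⟨j, hj⟩ := isCompact_univ.elim_directed_cover (fun j => {x | g x < F j x})
    (fun j => isOpen_lt hg (hF j)) (fun x _ => Set.mem_iUnion.mpr (h x))
    (directed_of_isDirected_le fun i j hij x (hx : g x < F i x) => hx.trans_le (hmono x hij))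
  exact ⟨j, fun x => hj (Set.mem_univ x)⟩

/-- The successive differences of the functions `cut k`. -/
noncomputable def bump : ℕ → ℝ → ℝ
  | 0 => cut 0
  | k + 1 => fun s => cut (k + 1) s - cut k s

theorem continuous_bump : ∀ k, Continuous (bump k)
  | 0 => continuous_cut 0
  | k + 1 => (continuous_cut (k + 1)).sub (continuous_cut k)

theorem bump_nonneg {s : ℝ} (hs : 0 ≤ s) : ∀ k, 0 ≤ bump k s
  | 0 => cut_nonneg 0 s
  | k + 1 => sub_nonneg.mpr (cut_mono k.le_succ hs)

theorem bump_le_cut (s : ℝ) : ∀ k, bump k s ≤ cut k s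
  | 0 => le_rfl
  | k + 1 => sub_le_self _ (cut_nonneg k s)

theorem sum_bump (s : ℝ) (k : ℕ) : ∑ i ∈ Finset.range (k + 1), bump i s = cut k s := by
  induction k with
  | zero => simp [bump]
  | succ k ih => rw [Finset.sum_range_succ, ih, bump]; ring

/-- `bump k` vanishes for `s ≤ 2⁻ᵏ`, and `bump l` vanishes once `cut (l - 1)` has reached `1`.
Adjacent bumps do overlap, whence the later split by parity. -/
theorem bump_mul_bump {k l : ℕ} (h : k + 2 ≤ l) {s : ℝ} (hs : 0 ≤ s) :
    bump k s * bump l s = 0 := by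
  obtain ⟨l, rfl⟩ : ∃ i, l = i + 1 := ⟨l - 1, by omega⟩
  rcases le_total (2 ^ k * s) 1 with h1 | h1
  · have h2 := bump_le_cut s k
    rw [cut_eq_zero h1] at h2
    rw [h2.antisymm (bump_nonneg hs k), zero_mul]
  · have h2 : 2 ≤ 2 ^ l * s := by
      calc (2 : ℝ) ≤ 2 * (2 ^ k * s) := by linarith
        _ = 2 ^ (k + 1) * s := by ring
        _ ≤ 2 ^ l * s :=
          mul_le_mul_of_nonneg_right (pow_le_pow_right₀ one_le_two (by omega)) hs
    have h3 : 2 ≤ 2 ^ (l + 1) * s := by rw [pow_succ]; linarith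
    simp [bump, cut_eq_one h2, cut_eq_one h3]

section RealCfc

variable {B : Type*} [CStarAlgebra B] [PartialOrder B] [StarOrderedRing B] {t : B →L[ℝ] ℝ}

/-- The functional calculus for real functions, as a function that mentions no instance besides the
C⋆-algebra structure. -/
noncomputable def realCfc {B : Type*} [CStarAlgebra B] (f : ℝ → ℝ) (a : B) : B := cfc f a

/-- The bumps telescope to the cut-offs, so the rank becomes a series of plain trace values. -/
theorem IsPosTrace.hasSum_bump (ht : IsPosTrace t) {a : B} (ha : 0 ≤ a) :
    HasSum (fun k => t (realCfc (bump k) a)) (dim t a) := by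
  simp only [realCfc]
  rw [hasSum_iff_tendsto_nat_of_nonneg fun k => ht.nonneg _
    (cfc_nonneg fun x hx => bump_nonneg (spectrum_nonneg ha hx) k)]
  rw [← tendsto_add_atTop_iff_nat 1]
  refine (ht.tendsto_cut ha).congr fun k => ?_
  rw [← map_sum, ← cfc_sum _ _ _ fun i _ => (continuous_bump i).continuousOn]
  congr 2
  ext s
  simp [sum_bump]

theorem realCfc_bump_nonneg {a : B} (ha : 0 ≤ a) (k : ℕ) : 0 ≤ realCfc (bump k) a :=
  cfc_nonneg fun _ hx => bump_nonneg (spectrum_nonneg ha hx) k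

theorem realCfc_bump_le_one (a : B) (k : ℕ) : realCfc (bump k) a ≤ 1 :=
  cfc_le_one _ _ fun x _ => (bump_le_cut x k).trans (cut_le_one k x)

theorem realCfc_bump_mul {a : B} (ha : 0 ≤ a) {k l : ℕ} (h : k + 2 ≤ l) :
    realCfc (bump k) a * realCfc (bump l) a = 0 := by
  rw [realCfc, realCfc,
    ← cfc_mul _ _ _ (continuous_bump k).continuousOn (continuous_bump l).continuousOn,
    ← cfc_zero ℝ a]
  exact cfc_congr fun x hx => bump_mul_bump h (spectrum_nonneg ha hx)

theorem exists_realCfc_bump_ne_zero {a : B} (ha : 0 ≤ a) (h0 : a ≠ 0) :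
    ∃ k, realCfc (bump k) a ≠ 0 := by
  by_contra! h
  apply h0
  rw [← cfc_id ℝ a, ← cfc_zero ℝ a]
  refine cfc_congr fun x hx => ?_
  have hx0 := spectrum_nonneg ha hx
  have hcut : ∀ k, cut k x = 0 := by
    intro k
    rw [← sum_bump]
    refine Finset.sum_eq_zero fun i _ => ?_
    have h1 : cfc (bump i) a = cfc (0 : ℝ → ℝ) a := (h i).trans (cfc_zero ℝ a).symm
    exact eqOn_of_cfc_eq_cfc h1 (continuous_bump i).continuousOn continuousOn_const
      (.of_nonneg ha) hx
  by_contra hne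
  have hxpos : 0 < x := lt_of_le_of_ne hx0 (Ne.symm hne)
  obtain ⟨k, hk⟩ := pow_unbounded_of_one_lt (2 / x) (one_lt_two (α := ℝ))
  rw [div_lt_iff₀ hxpos] at hk
  have := hcut k
  rw [cut_eq_one hk.le] at this
  exact one_ne_zero this

theorem exists_mul_self_eq {c : B} (hc : 0 ≤ c) :
    ∃ s, IsSelfAdjoint s ∧ s * s = c ∧ ∀ b, c * b = 0 → s * b = 0 := by
  refine ⟨cfc Real.sqrt c, cfc_predicate _ _, ?_, fun b hb =>
    cfc_mul_eq_zero Real.continuous_sqrt Real.sqrt_zero (.of_nonneg hc) hb⟩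
  rw [← cfc_mul Real.sqrt Real.sqrt c]
  conv_rhs => rw [← cfc_id ℝ c]
  exact cfc_congr fun x hx => Real.mul_self_sqrt (spectrum_nonneg hc hx)

/-- `hzc` is an algebraic substitute for `z k` lying in the hereditary subalgebra of `c k`. Applied
on both sides, it transfers orthogonality from `c` to `z`; even and odd indices are then summed
separately. -/
theorem exists_hasSum_dim_add_dim {z c : ℕ → B} (hz0 : ∀ k, 0 ≤ z k) (hz1 : ∀ k, z k ≤ 1)
    (hc0 : ∀ k, 0 ≤ c k) (hc : ∀ k l, k + 2 ≤ l → c k * c l = 0)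
    (hzc : ∀ k b, c k * b = 0 → z k * b = 0) :
    ∃ y₀ y₁ : B, 0 ≤ y₀ ∧ 0 ≤ y₁ ∧ ∀ t : B →L[ℝ] ℝ, IsPosTrace t →
      HasSum (fun k => dim t (z k)) (dim t y₀ + dim t y₁) := by
  have hzz : ∀ k l, k + 2 ≤ l → z k * z l = 0 := by
    intro k l h
    have h1 := congrArg star (hzc k (c l) (hc k l h))
    rw [star_mul, star_zero, (IsSelfAdjoint.of_nonneg (hc0 l)).star_eq,
      (IsSelfAdjoint.of_nonneg (hz0 k)).star_eq] at h1
    have h2 := congrArg star (hzc l (z k) h1)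
    rwa [star_mul, star_zero, (IsSelfAdjoint.of_nonneg (hz0 l)).star_eq,
      (IsSelfAdjoint.of_nonneg (hz0 k)).star_eq] at h2
  obtain ⟨y₀, hy₀, hs₀⟩ := exists_hasSum_dim (z := fun k => z (2 * k)) (fun k => hz0 _)
    (fun k => hz1 _) fun k l h => hzz _ _ (by omega)
  obtain ⟨y₁, hy₁, hs₁⟩ := exists_hasSum_dim (z := fun k => z (2 * k + 1)) (fun k => hz0 _)
    (fun k => hz1 _) fun k l h => hzz _ _ (by omega)
  exact ⟨y₀, y₁, hy₀, hy₁, fun t ht => HasSum.even_add_odd (hs₀ t ht) (hs₁ t ht)⟩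

theorem IsPosTrace.dim_zero (ht : IsPosTrace t) : dim t 0 = 0 := by
  have := ht.dim_add_of_mul_eq_zero le_rfl le_rfl (mul_zero 0)
  rw [add_zero] at this
  linarith

end RealCfc

/-! ### Elements of prescribed rank below a positive contraction -/

section Interpolation

variable {A : Type*} [CStarAlgebra A] [PartialOrder A] [StarOrderedRing A]

theorem abs_matrixTrace_le (τ : tracialStates A) {n : ℕ} (x : CStarMatrix (Fin n) (Fin n) A) :
    |matrixTrace τ x| ≤ 4 * n * ‖x‖ := by
  refine (Complex.abs_re_le_norm _).trans ((norm_sum_le_of_le (n := fun _ => 4 * ‖x‖)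
    Finset.univ fun i _ => ?_).trans (le_of_eq (by simp; ring)))
  exact (norm_apply_le_of_mem_tracialStates τ.2 _).trans
    (by gcongr; exact CStarMatrix.norm_entry_le_norm)

theorem conjTranspose_mul_self_mul_eq_zero {m n : ℕ} {v : CStarMatrix (Fin m) (Fin n) A}
    {s b : CStarMatrix (Fin n) (Fin n) A} (h : s * b = 0) :
    (v * s).conjTranspose * (v * s) * b = 0 := by
  have key : ∀ (v : Matrix (Fin m) (Fin n) A) (s b : Matrix (Fin n) (Fin n) A), s * b = 0 →
      (v * s).conjTranspose * (v * s) * b = 0 := by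
    intro v s b h
    rw [Matrix.mul_assoc, Matrix.mul_assoc, h, Matrix.mul_zero, Matrix.mul_zero]
  exact key v s b h

theorem mul_mul_conjTranspose_eq {m n : ℕ} (v : CStarMatrix (Fin m) (Fin n) A)
    {s c : CStarMatrix (Fin n) (Fin n) A} (hs : IsSelfAdjoint s) (h : s * s = c) :
    v * c * v.conjTranspose = v * s * (v * s).conjTranspose := by
  have key : ∀ (v : Matrix (Fin m) (Fin n) A) (s c : Matrix (Fin n) (Fin n) A),
      s.conjTranspose = s → s * s = c →
      v * c * v.conjTranspose = v * s * (v * s).conjTranspose := by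
    intro v s c hs h
    rw [Matrix.conjTranspose_mul, hs, ← h]
    simp only [Matrix.mul_assoc]
  exact key v s c hs h

/-- Below a nonzero positive contraction `c` there are elements whose rank lies strictly between
`τ(c) / (n + 1)` and `τ(c) / n` for all tracial states `τ`. -/
theorem exists_dim_mem_Ioo (hsimple : IsSimpleCStar A) (hcomp : StrictComparison A)
    (hdense : ∀ f ∈ Aff A, (∀ τ, 0 < f τ) → ∀ ε : ℝ, 0 < ε →
      ∃ a : PosMatrix A, ∀ τ, |f τ - dimFun τ a| < ε)
    {m : ℕ} {c : CStarMatrix (Fin m) (Fin m) A} (hc : 0 ≤ c) (hc1 : c ≤ 1) (hc0 : c ≠ 0)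
    {n : ℕ} (hn : 1 ≤ n) :
    ∃ z : CStarMatrix (Fin m) (Fin m) A, 0 ≤ z ∧ z ≤ 1 ∧ (∀ b, c * b = 0 → z * b = 0) ∧
      ∀ τ : tracialStates A, dim (reTrace τ m) z ∈
        Set.Ioo (matrixTrace τ c / (n + 1)) (matrixTrace τ c / n) := by
  have hn' : (1 : ℝ) ≤ n := by exact_mod_cast hn
  obtain ⟨η, hη, hηle⟩ := exists_pos_forall_le (continuous_matrixTrace c)
    fun τ => matrixTrace_pos hsimple τ hc hc0
  -- The target `τ(c)/(n + 1/2)` is more than `τ(c)/(2(n+1)²)` away from both ends of the interval,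
  -- and `η ≤ τ(c)` makes the tolerance uniform in `τ`.
  obtain ⟨y, hy⟩ := hdense _ (matrixTrace_mem_aff c (n + 1 / 2))
    (fun τ => div_pos (matrixTrace_pos hsimple τ hc hc0) (by positivity))
    (η / (2 * (n + 1) ^ 2)) (by positivity)
  simp only [ContinuousMap.coe_mk, abs_lt] at hy
  have hlow : ∀ τ : tracialStates A, matrixTrace τ c / (n + 1) < dimFun τ y := by
    intro τ
    have h1 := (hy τ).2
    have h2 : η / (2 * (n + 1) ^ 2) ≤ matrixTrace τ c / (2 * (n + 1) ^ 2) := by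
      gcongr; exact hηle τ
    have h3 : matrixTrace τ c / (n + 1) + matrixTrace τ c / (2 * (n + 1) ^ 2)
        ≤ matrixTrace τ c / (n + 1 / 2) := by
      have h4 := matrixTrace_pos hsimple τ hc hc0
      rw [← sub_nonneg]
      have : matrixTrace τ c / (n + 1 / 2) - (matrixTrace τ c / (n + 1)
          + matrixTrace τ c / (2 * (n + 1) ^ 2))
          = matrixTrace τ c / (4 * (n + 1 / 2) * (n + 1) ^ 2) := by
        field_simp; ring
      rw [this]
      positivity
    linarith
  have hupp : ∀ τ : tracialStates A, dimFun τ y < matrixTrace τ c / n := by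
    intro τ
    have h1 := (hy τ).1
    have h2 : η / (2 * (n + 1) ^ 2) ≤ matrixTrace τ c / (2 * (n + 1) ^ 2) := by
      gcongr; exact hηle τ
    have h3 : matrixTrace τ c / (n + 1 / 2) + matrixTrace τ c / (2 * (n + 1) ^ 2)
        ≤ matrixTrace τ c / n := by
      have h4 := matrixTrace_pos hsimple τ hc hc0
      rw [← sub_nonneg]
      have : matrixTrace τ c / n - (matrixTrace τ c / (n + 1 / 2)
          + matrixTrace τ c / (2 * (n + 1) ^ 2))
          = matrixTrace τ c * (3 * n / 2 + 1) / (2 * n * (n + 1 / 2) * (n + 1) ^ 2) := by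
        field_simp; ring
      rw [this]
      positivity
    linarith
  obtain ⟨v, hv⟩ : CuntzLE y.mat c := by
    refine hcomp y ⟨m, c, hc⟩ fun τ => (hupp τ).trans_le ?_
    rw [dimFun_eq_dim]
    refine le_trans ?_ ((isPosTrace_reTrace τ m).apply_le_dim hc hc1)
    exact div_le_self (matrixTrace_pos hsimple τ hc hc0).le hn'
  -- One cut-off level `j` already keeps the lower bound for all `τ` at once; `θ` below is the
  -- uniform margin left.
  obtain ⟨j, hj⟩ := exists_forall_lt_of_monotone
    (F := fun j (τ : tracialStates A) => matrixTrace τ (realCfc (cut j) y.mat))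
    ((continuous_matrixTrace c).div_const (n + 1 : ℝ)) (fun j => continuous_matrixTrace _)
    (fun τ _ _ h => (isPosTrace_reTrace τ _).mono (cfc_cut_mono y.nonneg h))
    (fun τ => by
      have h1 := hlow τ
      rw [dimFun_eq_dim] at h1
      exact exists_lt_of_lt_ciSup h1)
  obtain ⟨θ, hθ, hθle⟩ := exists_pos_forall_le
    ((continuous_matrixTrace (realCfc (cut j) y.mat)).sub
      ((continuous_matrixTrace c).div_const (n + 1 : ℝ))) fun τ => sub_pos.mpr (hj τ)
  obtain ⟨s, hssa, hss, hsb⟩ := exists_mul_self_eq hc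
  simp only [fun k => mul_mul_conjTranspose_eq (v k) hssa hss] at hv
  have hlim : Tendsto (fun k => realCfc (cut j) (v k * s * (v k * s).conjTranspose)) atTop
      (𝓝 (realCfc (cut j) y.mat)) := tendsto_cfc_of_tendsto (continuous_cut j)
    (fun k => isSelfAdjoint_mul_conjTranspose (v k * s)) (.of_nonneg y.nonneg) hv
  rw [Metric.tendsto_atTop] at hv hlim
  obtain ⟨k₁, hk₁⟩ := hv (2 ^ j)⁻¹ (by positivity)
  -- Matrix traces are bounded by `4 * y.size` times the norm; the `+ 1` covers size `0` and makes
  -- the resulting estimate strict.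
  obtain ⟨k₂, hk₂⟩ := hlim (θ / (4 * y.size + 1)) (by positivity)
  set k := max k₁ k₂
  have hd₁ := hk₁ k (le_max_left _ _)
  have hd₂ := hk₂ k (le_max_right _ _)
  rw [dist_eq_norm] at hd₁ hd₂
  set w := v k * s with hw
  -- With `w = v √c`, `w w*` is close to `y`, while `w* w` has the size of `c` and kills whatever
  -- `c` kills. The traces of their cut-offs agree, and so do the ranks.
  refine ⟨realCfc (cut j) (w.conjTranspose * w), cfc_cut_nonneg _ _, cfc_cut_le_one _ _,
    fun b hb => ?_, fun τ => ⟨?_, ?_⟩⟩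
  · refine cfc_mul_eq_zero (continuous_cut j) (cut_zero j) (isSelfAdjoint_conjTranspose_mul w) ?_
    exact conjTranspose_mul_self_mul_eq_zero (hsb b hb)
  -- Lower bound: the rank of a contraction is at least its trace, and that trace is within `θ` of
  -- `τ(cut j (y))`.
  · have h1 := (isPosTrace_reTrace τ m).apply_le_dim
      (cfc_cut_nonneg j (w.conjTranspose * w)) (cfc_cut_le_one _ _)
    refine lt_of_lt_of_le ?_ h1
    have h5 : reTrace τ y.size (realCfc (cut j) (w * w.conjTranspose))
        = reTrace τ m (realCfc (cut j) (w.conjTranspose * w)) :=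
      apply_cfc_eq_of_apply_pow (cut j) (continuous_cut j) (cut_zero j)
        (isSelfAdjoint_mul_conjTranspose w) (isSelfAdjoint_conjTranspose_mul w)
        (matrixTrace_pow_mul_conjTranspose τ w)
    refine lt_of_lt_of_eq ?_ h5
    have h2 : θ ≤ matrixTrace τ (realCfc (cut j) y.mat) - matrixTrace τ c / (n + 1) := hθle τ
    have h3 := abs_matrixTrace_le τ (realCfc (cut j) (w * w.conjTranspose) - realCfc (cut j) y.mat)
    have h4 : 4 * (y.size : ℝ) * ‖realCfc (cut j) (w * w.conjTranspose) - realCfc (cut j) y.mat‖ < θ := by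
      calc _ ≤ (4 * y.size) * (θ / (4 * y.size + 1)) := by gcongr
        _ < (4 * y.size + 1) * (θ / (4 * y.size + 1)) := by gcongr; linarith
        _ = θ := by field_simp
    rw [← reTrace_apply, map_sub, abs_le] at h3
    simp only [reTrace_apply] at h3 ⊢
    linarith [h3.1]
  -- Upper bound: `w w*` is within `2⁻ʲ` of `y`, so its cut-off at level `j` has rank at most that
  -- of `y`.
  · have h5 : dim (reTrace τ y.size) (realCfc (cut j) (w * w.conjTranspose))
        = dim (reTrace τ m) (realCfc (cut j) (w.conjTranspose * w)) :=
      dim_cfc_eq_of_apply_pow (cut j) (continuous_cut j) (cut_zero j)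
        (isSelfAdjoint_mul_conjTranspose w) (isSelfAdjoint_conjTranspose_mul w)
        (matrixTrace_pow_mul_conjTranspose τ w)
    refine lt_of_le_of_lt ?_ (hupp τ)
    rw [← h5]
    rw [dimFun_eq_dim]
    exact (isPosTrace_reTrace τ _).dim_cfc_cut_le_of_norm_sub_le
      (isSelfAdjoint_mul_conjTranspose w) y.nonneg hd₁.le

end Interpolation

/-! ### Summing the pieces, and multiples in `W(A)` -/

section Divisibility

variable {A : Type*} [CStarAlgebra A] [PartialOrder A] [StarOrderedRing A]

/-- Some bumps may vanish; for those `z = 0` and only the weak inequalities survive. -/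
theorem exists_dim_mem_Icc (hsimple : IsSimpleCStar A) (hcomp : StrictComparison A)
    (hdense : ∀ f ∈ Aff A, (∀ τ, 0 < f τ) → ∀ ε : ℝ, 0 < ε →
      ∃ a : PosMatrix A, ∀ τ, |f τ - dimFun τ a| < ε)
    {m : ℕ} {c : CStarMatrix (Fin m) (Fin m) A} (hc : 0 ≤ c) (hc1 : c ≤ 1) {n : ℕ} (hn : 1 ≤ n) :
    ∃ z : CStarMatrix (Fin m) (Fin m) A, 0 ≤ z ∧ z ≤ 1 ∧ (∀ b, c * b = 0 → z * b = 0) ∧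
      (∀ τ : tracialStates A, dim (reTrace τ m) z ∈
        Set.Icc (matrixTrace τ c / (n + 1)) (matrixTrace τ c / n)) ∧
      (c ≠ 0 → ∀ τ : tracialStates A, dim (reTrace τ m) z ∈
        Set.Ioo (matrixTrace τ c / (n + 1)) (matrixTrace τ c / n)) := by
  by_cases h : c = 0
  · refine ⟨0, le_rfl, zero_le_one, fun b _ => zero_mul b, fun τ => ?_, fun h' => absurd h h'⟩
    have h1 : matrixTrace τ (0 : CStarMatrix (Fin m) (Fin m) A) = 0 := map_zero (reTrace τ m)
    rw [(isPosTrace_reTrace τ m).dim_zero]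
    simp [h, h1]
  · obtain ⟨z, h0, h1, h2, h3⟩ := exists_dim_mem_Ioo hsimple hcomp hdense hc hc1 h hn
    exact ⟨z, h0, h1, h2, fun τ => Set.Ioo_subset_Icc_self (h3 τ), fun _ => h3⟩

theorem exists_dimFun_mem_Ioo (hsimple : IsSimpleCStar A) (hcomp : StrictComparison A)
    (hdense : ∀ f ∈ Aff A, (∀ τ, 0 < f τ) → ∀ ε : ℝ, 0 < ε →
      ∃ a : PosMatrix A, ∀ τ, |f τ - dimFun τ a| < ε)
    (a : PosMatrix A) (ha : a.mat ≠ 0) {n : ℕ} (hn : 1 ≤ n) :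
    ∃ y : PosMatrix A, ∀ τ : tracialStates A,
      dimFun τ y ∈ Set.Ioo (dimFun τ a / (n + 1)) (dimFun τ a / n) := by
  set c := fun k => realCfc (bump k) a.mat
  have hc : ∀ k, 0 ≤ c k := realCfc_bump_nonneg a.nonneg
  have hc1 : ∀ k, c k ≤ 1 := realCfc_bump_le_one a.mat
  have hcc : ∀ k l, k + 2 ≤ l → c k * c l = 0 := fun k l => realCfc_bump_mul a.nonneg
  have hz := fun k => exists_dim_mem_Icc hsimple hcomp hdense (hc k) (hc1 k) hn
  choose z hz0 hz1 hzc hzI hzs using hz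
  obtain ⟨y₀, y₁, hy₀, hy₁, hs⟩ := exists_hasSum_dim_add_dim hz0 hz1 hc hcc hzc
  obtain ⟨k₀, hk₀⟩ : ∃ k, c k ≠ 0 := exists_realCfc_bump_ne_zero a.nonneg ha
  refine ⟨⟨a.size, y₀, hy₀⟩ + ⟨a.size, y₁, hy₁⟩, fun τ => ?_⟩
  have ht := isPosTrace_reTrace τ a.size
  have hsum := hs _ ht
  have hsa : HasSum (fun k => matrixTrace τ (c k)) (dim (reTrace τ a.size) a.mat) :=
    ht.hasSum_bump a.nonneg
  rw [dimFun_add, dimFun_eq_dim, dimFun_eq_dim, dimFun_eq_dim]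
  -- Weak inequalities termwise and a strict one at `k₀` make the sums strictly ordered.
  exact ⟨hasSum_lt (fun k => (hzI k τ).1) (hzs k₀ hk₀ τ).1 (hsa.div_const _) hsum,
    hasSum_lt (fun k => (hzI k τ).2) (hzs k₀ hk₀ τ).2 hsum (hsa.div_const _)⟩

theorem exists_mk_eq_nsmul (y : PosMatrix A) (n : ℕ) :
    ∃ b : PosMatrix A, CuntzSemigroup.mk b = n • CuntzSemigroup.mk y ∧
      ∀ τ : tracialStates A, dimFun τ b = n * dimFun τ y := by
  induction n with
  | zero =>
    refine ⟨0, (zero_nsmul _).symm, fun τ => ?_⟩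
    -- With additivity this forces `d_τ(0) = 0`.
    have h : dimFun τ (0 + 0 : PosMatrix A) = dimFun τ 0 := by
      rw [dimFun_eq_dim, dimFun_eq_dim]
      refine dim_eq_of_apply_pow (.of_nonneg (0 + 0 : PosMatrix A).nonneg)
        (.of_nonneg (0 : PosMatrix A).nonneg) fun k => ?_
      simp only [reTrace_apply, matrixTrace]
      rfl
    rw [dimFun_add] at h
    push_cast
    linarith
  | succ n ih =>
    obtain ⟨b, hb, hd⟩ := ih
    refine ⟨b + y, ?_, fun τ => ?_⟩
    · rw [succ_nsmul, ← hb, CuntzSemigroup.mk_add_mk]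
    · rw [dimFun_add, hd]; push_cast; ring

end Divisibility

end CuntzDiv

theorem proposition2p1 (A : Type*) [CStarAlgebra A] [PartialOrder A] [StarOrderedRing A]
    (hsimple : CuntzDiv.IsSimpleCStar A)
    (hfinite : CuntzDiv.IsStablyFinite A)
    (hcomp : CuntzDiv.StrictComparison A)
    (hdense : ∀ f ∈ CuntzDiv.Aff A, (∀ τ, 0 < f τ) → ∀ ε : ℝ, 0 < ε →
      ∃ a : CuntzDiv.PosMatrix A, ∀ τ, |f τ - CuntzDiv.dimFun τ a| < ε) :
    CuntzDiv.AlmostDivisible (CuntzDiv.CuntzSemigroup A) := by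
  intro x n
  induction x using Quotient.inductionOn with | _ a
  change ∃ y, n • y ≤ CuntzDiv.CuntzSemigroup.mk a ∧ CuntzDiv.CuntzSemigroup.mk a ≤ (n + 1) • y
  rcases Nat.eq_zero_or_pos n with rfl | hn
  · refine ⟨CuntzDiv.CuntzSemigroup.mk a, ?_, by simp⟩
    rw [zero_nsmul]
    refine CuntzDiv.CuntzSemigroup.mk_le_mk (a := 0).mpr ⟨fun _ => 0, ?_⟩
    refine tendsto_const_nhds.congr fun _ => ?_
    ext i
    exact i.elim0
  -- For `a = 0` all ranks vanish and no strict inequality is available; `y = 0` works directly.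
  by_cases ha : a.mat = 0
  · have h0 : CuntzDiv.CuntzSemigroup.mk a ≤ 0 :=
      CuntzDiv.CuntzSemigroup.mk_le_mk (b := 0).mpr ⟨fun _ => 0, by
        refine tendsto_const_nhds.congr fun _ => ?_
        rw [ha]
        ext i j
        simp [CStarMatrix.mul_apply]⟩
    refine ⟨0, ?_, by simpa using h0⟩
    rw [nsmul_zero]
    refine CuntzDiv.CuntzSemigroup.mk_le_mk (a := 0).mpr ⟨fun _ => 0, ?_⟩
    refine tendsto_const_nhds.congr fun _ => ?_
    ext i
    exact i.elim0
  · obtain ⟨y, hy⟩ := CuntzDiv.exists_dimFun_mem_Ioo hsimple hcomp hdense a ha hn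
    refine ⟨CuntzDiv.CuntzSemigroup.mk y, ?_, ?_⟩
    · obtain ⟨b, hb, hd⟩ := CuntzDiv.exists_mk_eq_nsmul y n
      rw [← hb]
      refine CuntzDiv.CuntzSemigroup.mk_le_mk.mpr (hcomp b a fun τ => ?_)
      rw [hd, mul_comm, ← lt_div_iff₀ (by exact_mod_cast hn)]
      exact (hy τ).2
    · obtain ⟨b, hb, hd⟩ := CuntzDiv.exists_mk_eq_nsmul y (n + 1)
      rw [← hb]
      refine CuntzDiv.CuntzSemigroup.mk_le_mk.mpr (hcomp a b fun τ => ?_)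
      rw [hd, mul_comm, ← div_lt_iff₀ (by positivity)]
      exact_mod_cast (hy τ).1
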